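/- Let $k\le n$, let $A$ be an $n\times k$ matrix with integer entries, and let the torus $T^k=\{e^{iv}:v\in\mathbb R^k\}$ act on $\mathbb C^n$ by $\rho(e^{iv})z=e^{iAv}z$. Let $\mathfrak t^k=i\mathbb R^k$ carry its standard inner product, write $L_z\xi=\dot\rho(\xi)z$ for $\xi\in\mathfrak t^k$, and let $\mu:\mathbb C^n\to\mathfrak t^k$ be the moment map with $\mu(0)=0$ and $d\langle\mu,\xi\rangle=\omega(L_z\xi,\cdot)$, $\omega=\sum_j dx_j\wedge dy_j$, that is, $\mu(z)=-\tfrac i2A^T(|z_1|^2,\dots,|z_n|^2)^T$. Assume that $\mu$ is proper and that $\tau\in\mathfrak t^k$ is a regular value of $\mu$. Let $S^1=\mathbb R/\mathbb Z$, $\mathscr L=C^\infty(S^1,\mathbb C^n\times\mathfrak t^k)$ and $\mathscr L_0=C^\infty(S^1,\mathbb C^n)\times\mathfrak t^k\subset\mathscr L$ (constant second component). For $z\in C^\infty(S^1,\mathbb C^n)$ put $\bar\mu(z)=\int_0^1\mu(z(t))\,dt$, and let $$\mathcal A_0(z,\eta)=\int_0^1\sum_j y_j\,\partial_t x_j\,dt+\langle\eta,\bar\mu(z)-\tau\rangle,\qquad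 (z,\eta)\in\mathscr L_0,\ z=x+iy.$$ For $r\in(0,1]$ let the group $\mathcal H_0$ of gauge transformations $h=\exp\xi$, where $\xi\in C^\infty(S^1,\mathfrak t^k)$ and $\int_0^1\xi\,dt=0$, act on $\mathscr L$ by $h_{*_r}(z,\eta)=(\rho(h)z,\ \eta-\tfrac1r h^{-1}\partial_th)$. Each orbit meets $\mathscr L_0$ in exactly one point. Let $g_r$ be the metric on $\mathscr L_0\cong\mathscr L/_r\mathcal H_0$ induced as quotient metric by the $L^2$-metric on $\mathscr L$. A flow line of $\mathcal A_0$ with respect to $g_r$ is a pair $(z,\eta)\in C^\infty(\mathbb R\times S^1,\mathbb C^n)\times C^\infty(\mathbb R,\mathfrak t^k)$ such that $\partial_s(z,\eta)(s)=-\nabla_r\mathcal A_0((z,\eta)(s))$ for all $s\in\mathbb R$, where $\nabla_r$ is the gradient with respect to $g_r$. Its energy is $$E(z,\eta)=\int_{-\infty}^\infty\int_0^1\big(\|\partial_tz+L_z\eta\|^2+\|\bar\mu(z)-\tau\|^2\big)\,dt\,ds.$$ Then there is a compact set $K\subset\mathbb C^n$ such that for every $r\in(0,1]$ and every flow line $(z,\eta)$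 of $\mathcal A_0$ with respect to $g_r$ with $E(z,\eta)<\infty$, $$z(s,t)\in K\qquad\text{for all } s\in\mathbb R,\ t\in S^1.$$ -/

import Mathlib

noncomputable section

namespace MomentFloer

open scoped ContDiff

/-- The symplectic vector space `ℂⁿ`. -/
abbrev CSpace (n : ℕ) : Type := EuclideanSpace ℂ (Fin n)

/-- The Lie algebra `𝔱ᵏ = iℝᵏ` of the torus, with its standard inner product; the element `iv` is
represented by the real vector `v`. -/
abbrev TorusLie (k : ℕ) : Type := EuclideanSpace ℝ (Fin k)

variable {n k : ℕ}

/-- The `j`-th entry of the real vector `Aξ`. -/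
def weight (A : Matrix (Fin n) (Fin k) ℤ) (ξ : TorusLie k) (j : Fin n) : ℝ :=
  ∑ l, (A j l : ℝ) * ξ l

/-- The action `ρ(exp ξ) z = e^{iAξ} z` of the torus on `ℂⁿ`. -/
def torusAction (A : Matrix (Fin n) (Fin k) ℤ) (ξ : TorusLie k) (z : CSpace n) : CSpace n :=
  WithLp.toLp 2 fun j => Complex.exp (Complex.I * (weight A ξ j : ℂ)) * z j

/-- The infinitesimal action `L_z ξ = X_ξ(z)`. -/
def infAction (A : Matrix (Fin n) (Fin k) ℤ) (z : CSpace n) (ξ : TorusLie k) : CSpace n :=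
  WithLp.toLp 2 fun j => Complex.I * (weight A ξ j : ℂ) * z j

/-- The standard symplectic form `ω = ∑ dxⱼ ∧ dyⱼ`. -/
def symplecticForm (v w : CSpace n) : ℝ :=
  ∑ j, ((v j).re * (w j).im - (v j).im * (w j).re)

/-- The moment map of the torus action, normalized by `μ(0) = 0` and `d⟨μ, ξ⟩ = ω(X_ξ, ·)`
(see `hasDerivAt_inner_momentMap`). -/
def momentMap (A : Matrix (Fin n) (Fin k) ℤ) (z : CSpace n) : TorusLie k :=
  WithLp.toLp 2 fun l => -(1 / 2 : ℝ) * ∑ j, (A j l : ℝ) * ‖z j‖ ^ 2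

/-- `τ` is a regular value of `f`. -/
def IsRegularValue (f : CSpace n → TorusLie k) (τ : TorusLie k) : Prop :=
  ∀ z, f z = τ → Function.Surjective (fderiv ℝ f z)

/-- Smooth loops `S¹ = ℝ/ℤ → E`, as smooth `1`-periodic maps on `ℝ`. -/
def IsSmoothLoop {E : Type*} [NormedAddCommGroup E] [NormedSpace ℝ E] (f : ℝ → E) : Prop :=
  ContDiff ℝ ∞ f ∧ Function.Periodic f 1

/-- The Lie algebra of the group `ℋ₀` of normalized gauge transformations `exp ξ`. -/
def lieGauge (k : ℕ) : Set (ℝ → TorusLie k) :=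
  {ξ | IsSmoothLoop ξ ∧ ∫ t in (0 : ℝ)..1, ξ t = 0}

/-- The inclusion `ι` of `ℒ₀` (loops whose `𝔱ᵏ`-component is constant) into the space `ℒ` of loops
in `ℂⁿ × 𝔱ᵏ`; also used for tangent vectors. -/
def incl (p : (ℝ → CSpace n) × TorusLie k) : (ℝ → CSpace n) × (ℝ → TorusLie k) :=
  (p.1, fun _ => p.2)

/-- The moment action functional on `ℒ`, where the Liouville form is `λ = ∑ yⱼ dxⱼ`. -/
def action (A : Matrix (Fin n) (Fin k) ℤ) (τ : TorusLie k)
    (p : (ℝ → CSpace n) × (ℝ → TorusLie k)) : ℝ :=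
  (∫ t in (0 : ℝ)..1, ∑ j, (p.1 t j).im * (deriv p.1 t j).re) +
    ∫ t in (0 : ℝ)..1, inner ℝ (momentMap A (p.1 t) - τ) (p.2 t)

/-- The restriction `𝒜₀ = ι^* 𝒜`. -/
def action₀ (A : Matrix (Fin n) (Fin k) ℤ) (τ : TorusLie k)
    (p : (ℝ → CSpace n) × TorusLie k) : ℝ :=
  action A τ (incl p)

/-- The `L²`-metric `g` on `ℒ`. -/
def l2Metric (v w : (ℝ → CSpace n) × (ℝ → TorusLie k)) : ℝ :=
  ∫ t in (0 : ℝ)..1, ((inner ℂ (v.1 t) (w.1 t)).re + inner ℝ (v.2 t) (w.2 t))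

/-- The action on `ℒ` of the gauge transformation `exp ξ ∈ ℋ₀`, deformed by the parameter `r`. -/
def gaugeAction (A : Matrix (Fin n) (Fin k) ℤ) (r : ℝ) (ξ : ℝ → TorusLie k)
    (p : (ℝ → CSpace n) × (ℝ → TorusLie k)) : (ℝ → CSpace n) × (ℝ → TorusLie k) :=
  (fun t => torusAction A (ξ t) (p.1 t), fun t => p.2 t - (1 / r) • deriv ξ t)

/-- The infinitesimal deformed gauge action of `ξ ∈ Lie(ℋ₀)` at a point of `ℒ` with first
component `z` (see `hasDerivAt_gaugeAction`). -/
def infGauge (A : Matrix (Fin n) (Fin k) ℤ) (r : ℝ) (z : ℝ → CSpace n) (ξ : ℝ → TorusLie k) :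
    (ℝ → CSpace n) × (ℝ → TorusLie k) :=
  (fun t => infAction A (z t) (ξ t), fun t => -((1 / r) • deriv ξ t))

/-- The squared length of the class of `v ∈ T_{(z,η)} ℒ` in the quotient of `ℒ` by the deformed
action of `ℋ₀`: the infimum of the squared `L²`-length over all representatives of that class. -/
def quotientLengthSq (A : Matrix (Fin n) (Fin k) ℤ) (r : ℝ) (z : ℝ → CSpace n)
    (v : (ℝ → CSpace n) × (ℝ → TorusLie k)) : ℝ :=
  sInf ((fun ξ => l2Metric (v - infGauge A r z ξ) (v - infGauge A r z ξ)) '' lieGauge k)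

/-- The metric `g_r` on `ℒ₀` at a point with first component `z`: the pull-back, to
`ℒ₀ ≅ ℒ /_r ℋ₀`, of the quotient metric of `g`, obtained from the quotient length by polarization
(it is the `L²`-product of the horizontal representatives, see `quotientMetric_eq`). -/
def quotientMetric (A : Matrix (Fin n) (Fin k) ℤ) (r : ℝ) (z : ℝ → CSpace n)
    (v w : (ℝ → CSpace n) × TorusLie k) : ℝ :=
  (quotientLengthSq A r z (incl (v + w)) - quotientLengthSq A r z (incl (v - w))) / 4

/-- `v ∈ T_p ℒ₀` is the gradient of `𝒜₀` at `p ∈ ℒ₀` with respect to `g_r`, i.e.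
`d𝒜₀(p) w = g_r(v, w)` for all `w ∈ T_p ℒ₀`. -/
def IsGradient (A : Matrix (Fin n) (Fin k) ℤ) (τ : TorusLie k) (r : ℝ)
    (p v : (ℝ → CSpace n) × TorusLie k) : Prop :=
  IsSmoothLoop v.1 ∧ ∀ w : (ℝ → CSpace n) × TorusLie k, IsSmoothLoop w.1 →
    HasDerivAt (fun ε : ℝ => action₀ A τ (p + ε • w)) (quotientMetric A r p.1 v w) 0

/-- `(z, η)` is a (negative) gradient flow line `ℝ → ℒ₀` of `𝒜₀` with respect to `g_r`. -/
structure IsFlowLine (A : Matrix (Fin n) (Fin k) ℤ) (τ : TorusLie k) (r : ℝ)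
    (z : ℝ → ℝ → CSpace n) (η : ℝ → TorusLie k) : Prop where
  smooth_fst : ContDiff ℝ ∞ fun p : ℝ × ℝ => z p.1 p.2
  smooth_snd : ContDiff ℝ ∞ η
  periodic : ∀ s, Function.Periodic (z s) 1
  flow : ∀ s, IsGradient A τ r (z s, η s) (-(fun t => deriv (fun σ => z σ t) s, deriv η s))

/-- The mean value `μ̄(z)` of the moment map along a loop. -/
def meanMoment (A : Matrix (Fin n) (Fin k) ℤ) (z : ℝ → CSpace n) : TorusLie k :=
  ∫ t in (0 : ℝ)..1, momentMap A (z t)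

/-- The energy of `(z, η)`, possibly infinite. -/
def energy (A : Matrix (Fin n) (Fin k) ℤ) (τ : TorusLie k)
    (z : ℝ → ℝ → CSpace n) (η : ℝ → TorusLie k) : ENNReal :=
  ∫⁻ s : ℝ, ∫⁻ t in Set.Icc (0 : ℝ) 1, ENNReal.ofReal
    (‖deriv (z s) t + infAction A (z s t) (η s)‖ ^ 2 + ‖meanMoment A (z s) - τ‖ ^ 2)

/-! Checks of the conventions. -/

theorem hasDerivAt_inner_momentMap (A : Matrix (Fin n) (Fin k) ℤ) (ξ : TorusLie k)
    (z w : CSpace n) :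
    HasDerivAt (fun ε : ℝ => inner ℝ (momentMap A (z + ε • w)) ξ)
      (symplecticForm (infAction A z ξ) w) 0 := by
  have key : ∀ ε : ℝ, inner ℝ (momentMap A (z + ε • w)) ξ =
      ∑ j, -(1 / 2 : ℝ) * weight A ξ j *
        (((z j).re + ε * (w j).re) ^ 2 + ((z j).im + ε * (w j).im) ^ 2) := by
    intro ε
    simp only [momentMap, weight, PiLp.inner_apply, RCLike.inner_apply, conj_trivial,
      Finset.mul_sum, Finset.sum_mul]
    rw [Finset.sum_comm]
    refine Finset.sum_congr rfl fun j _ => Finset.sum_congr rfl fun l _ => ?_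
    rw [Complex.sq_norm, Complex.normSq_apply]
    simp
    ring
  simp only [key, symplecticForm]
  refine HasDerivAt.fun_sum fun j _ => ?_
  have h1 : HasDerivAt (fun ε : ℝ => (z j).re + ε * (w j).re) (w j).re 0 := by
    simpa using ((hasDerivAt_id (0 : ℝ)).mul_const (w j).re).const_add (z j).re
  have h2 : HasDerivAt (fun ε : ℝ => (z j).im + ε * (w j).im) (w j).im 0 := by
    simpa using ((hasDerivAt_id (0 : ℝ)).mul_const (w j).im).const_add (z j).im
  refine HasDerivAt.congr_deriv
    (((h1.pow 2).add (h2.pow 2)).const_mul (-(1 / 2 : ℝ) * weight A ξ j)) ?_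
  simp [infAction]
  ring

theorem hasDerivAt_gaugeAction (A : Matrix (Fin n) (Fin k) ℤ) (r : ℝ) {ξ : ℝ → TorusLie k}
    (hξ : ξ ∈ lieGauge k) (p : (ℝ → CSpace n) × (ℝ → TorusLie k)) (t : ℝ) :
    HasDerivAt (fun ε : ℝ => (gaugeAction A r (ε • ξ) p).1 t) ((infGauge A r p.1 ξ).1 t) 0 ∧
    HasDerivAt (fun ε : ℝ => (gaugeAction A r (ε • ξ) p).2 t) ((infGauge A r p.1 ξ).2 t) 0 := by
  constructor
  · refine ((PiLp.continuousLinearEquiv 2 ℝ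
      (fun _ : Fin n => ℂ)).symm.hasFDerivAt).comp_hasDerivAt 0 (hasDerivAt_pi.2 fun j => ?_)
    have hw : ∀ ε : ℝ, weight A ((ε • ξ) t) j = ε * weight A (ξ t) j := fun ε => by
      simp only [weight, Pi.smul_apply, PiLp.smul_apply, smul_eq_mul, Finset.mul_sum]
      exact Finset.sum_congr rfl fun l _ => by ring
    simp only [hw]
    have h0 : HasDerivAt (fun ε : ℝ => ((ε * weight A (ξ t) j : ℝ) : ℂ))
        ((weight A (ξ t) j : ℝ) : ℂ) 0 := by
      simpa using ((hasDerivAt_id (0 : ℝ)).mul_const (weight A (ξ t) j)).ofReal_comp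
    simpa using ((h0.const_mul Complex.I).cexp).mul_const (p.1 t j)
  · have hd : DifferentiableAt ℝ ξ t := hξ.1.1.differentiable (by simp) t
    have hs : ∀ ε : ℝ, deriv (ε • ξ) t = ε • deriv ξ t := fun ε => deriv_const_smul ε hd
    simp only [gaugeAction, infGauge, hs]
    have := (((hasDerivAt_id (0 : ℝ)).smul_const (deriv ξ t)).const_smul (1 / r)).const_sub (p.2 t)
    simpa using this

theorem l2Metric_add_left {u v w : (ℝ → CSpace n) × (ℝ → TorusLie k)}
    (hu : Continuous u.1 ∧ Continuous u.2) (hv : Continuous v.1 ∧ Continuous v.2)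
    (hw : Continuous w.1 ∧ Continuous w.2) :
    l2Metric (u + v) w = l2Metric u w + l2Metric v w := by
  obtain ⟨hu1, hu2⟩ := hu
  obtain ⟨hv1, hv2⟩ := hv
  obtain ⟨hw1, hw2⟩ := hw
  unfold l2Metric
  rw [← intervalIntegral.integral_add]
  · refine intervalIntegral.integral_congr fun t _ => ?_
    simp [inner_add_left]
    ring
  · exact ((Complex.continuous_re.comp (hu1.inner hw1)).add (hu2.inner hw2)).intervalIntegrable _ _
  · exact ((Complex.continuous_re.comp (hv1.inner hw1)).add (hv2.inner hw2)).intervalIntegrable _ _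

theorem l2Metric_neg_left (u w : (ℝ → CSpace n) × (ℝ → TorusLie k)) :
    l2Metric (-u) w = -l2Metric u w := by
  unfold l2Metric
  rw [← intervalIntegral.integral_neg]
  refine intervalIntegral.integral_congr fun t _ => ?_
  simp
  ring

theorem l2Metric_comm (u w : (ℝ → CSpace n) × (ℝ → TorusLie k)) :
    l2Metric u w = l2Metric w u := by
  unfold l2Metric
  refine intervalIntegral.integral_congr fun t _ => ?_
  rw [← inner_conj_symm, Complex.conj_re, real_inner_comm]

theorem l2Metric_self_nonneg (u : (ℝ → CSpace n) × (ℝ → TorusLie k)) : 0 ≤ l2Metric u u :=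
  intervalIntegral.integral_nonneg zero_le_one fun _ _ =>
    add_nonneg (inner_self_nonneg (𝕜 := ℂ)) real_inner_self_nonneg

theorem continuous_infGauge (A : Matrix (Fin n) (Fin k) ℤ) (r : ℝ) {z : ℝ → CSpace n}
    (hz : IsSmoothLoop z) {ξ : ℝ → TorusLie k} (hξ : ξ ∈ lieGauge k) :
    Continuous (infGauge A r z ξ).1 ∧ Continuous (infGauge A r z ξ).2 := by
  have h1 := hz.1.continuous
  have h2 := hξ.1.1.continuous
  have h3 : Continuous (deriv ξ) := hξ.1.1.continuous_deriv (by simp)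
  constructor
  · simp only [infGauge, infAction, weight]
    fun_prop
  · simp only [infGauge]
    fun_prop

theorem lieGauge_add {ξ ζ : ℝ → TorusLie k} (hξ : ξ ∈ lieGauge k) (hζ : ζ ∈ lieGauge k) :
    ξ + ζ ∈ lieGauge k := by
  refine ⟨⟨hξ.1.1.add hζ.1.1, hξ.1.2.add hζ.1.2⟩, ?_⟩
  have := intervalIntegral.integral_add (hξ.1.1.continuous.intervalIntegrable 0 1)
    (hζ.1.1.continuous.intervalIntegrable 0 1) (μ := MeasureTheory.volume)
  simpa [hξ.2, hζ.2] using this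

theorem lieGauge_neg {ξ : ℝ → TorusLie k} (hξ : ξ ∈ lieGauge k) : -ξ ∈ lieGauge k := by
  refine ⟨⟨hξ.1.1.neg, fun t => by simp [hξ.1.2 t]⟩, ?_⟩
  simpa using hξ.2

theorem infGauge_add (A : Matrix (Fin n) (Fin k) ℤ) (r : ℝ) (z : ℝ → CSpace n)
    {ξ ζ : ℝ → TorusLie k} (hξ : ξ ∈ lieGauge k) (hζ : ζ ∈ lieGauge k) :
    infGauge A r z (ξ + ζ) = infGauge A r z ξ + infGauge A r z ζ := by
  refine Prod.ext (funext fun t => ?_) (funext fun t => ?_)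
  · ext j
    simp [infGauge, infAction, weight, mul_add, add_mul, Finset.sum_add_distrib]
  · have h1 : DifferentiableAt ℝ ξ t := hξ.1.1.differentiable (by simp) t
    have h2 : DifferentiableAt ℝ ζ t := hζ.1.1.differentiable (by simp) t
    simp only [infGauge, deriv_add h1 h2, Prod.snd_add, Pi.add_apply, smul_add, neg_add]

theorem infGauge_neg (A : Matrix (Fin n) (Fin k) ℤ) (r : ℝ) (z : ℝ → CSpace n)
    (ξ : ℝ → TorusLie k) : infGauge A r z (-ξ) = -infGauge A r z ξ := by
  refine Prod.ext (funext fun t => ?_) (funext fun t => ?_)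
  · ext j
    simp [infGauge, infAction, weight]
  · simp [infGauge, deriv.neg]

/-- The quotient length is the length of a horizontal representative, if there is one. -/
theorem quotientLengthSq_eq (A : Matrix (Fin n) (Fin k) ℤ) (r : ℝ) {z : ℝ → CSpace n}
    (hz : IsSmoothLoop z) {h : (ℝ → CSpace n) × (ℝ → TorusLie k)}
    (hh : Continuous h.1 ∧ Continuous h.2) {ξ : ℝ → TorusLie k} (hξ : ξ ∈ lieGauge k)
    (hor : ∀ χ ∈ lieGauge k, l2Metric h (infGauge A r z χ) = 0) :
    quotientLengthSq A r z (h + infGauge A r z ξ) = l2Metric h h := by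
  refine IsLeast.csInf_eq ⟨⟨ξ, hξ, by simp⟩, ?_⟩
  rintro _ ⟨χ, hχ, rfl⟩
  have e : h + infGauge A r z ξ - infGauge A r z χ = h + infGauge A r z (ξ + -χ) := by
    rw [infGauge_add A r z hξ (lieGauge_neg hχ), infGauge_neg]
    abel
  have hm := lieGauge_add hξ (lieGauge_neg hχ)
  have hG := continuous_infGauge A r hz hm
  have hs : Continuous (h + infGauge A r z (ξ + -χ)).1 ∧
      Continuous (h + infGauge A r z (ξ + -χ)).2 := ⟨hh.1.add hG.1, hh.2.add hG.2⟩
  simp only [e]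
  rw [l2Metric_add_left hh hG hs, l2Metric_comm h (_ + _),
    l2Metric_comm (infGauge A r z _) (_ + _), l2Metric_add_left hh hG hh,
    l2Metric_add_left hh hG hG, l2Metric_comm (infGauge A r z _) h, hor _ hm]
  linarith [l2Metric_self_nonneg (infGauge A r z (ξ + -χ))]

/-- At a point of `ℒ₀`, `g_r` is the `L²`-product of the horizontal representatives. -/
theorem quotientMetric_eq (A : Matrix (Fin n) (Fin k) ℤ) (r : ℝ) {z : ℝ → CSpace n}
    (hz : IsSmoothLoop z) {v w : (ℝ → CSpace n) × TorusLie k}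
    (hv : IsSmoothLoop v.1) (hw : IsSmoothLoop w.1) {ξ ζ : ℝ → TorusLie k}
    (hξ : ξ ∈ lieGauge k) (hζ : ζ ∈ lieGauge k)
    (hvξ : ∀ χ ∈ lieGauge k, l2Metric (incl v - infGauge A r z ξ) (infGauge A r z χ) = 0)
    (hwζ : ∀ χ ∈ lieGauge k, l2Metric (incl w - infGauge A r z ζ) (infGauge A r z χ) = 0) :
    quotientMetric A r z v w =
      l2Metric (incl v - infGauge A r z ξ) (incl w - infGauge A r z ζ) := by
  have hGξ := continuous_infGauge A r hz hξ
  have hGζ := continuous_infGauge A r hz hζ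
  obtain ⟨a, ha⟩ : ∃ a, a = incl v - infGauge A r z ξ := ⟨_, rfl⟩
  obtain ⟨b, hb⟩ : ∃ b, b = incl w - infGauge A r z ζ := ⟨_, rfl⟩
  have hac : Continuous a.1 ∧ Continuous a.2 := by
    rw [ha]; exact ⟨hv.1.continuous.sub hGξ.1, continuous_const.sub hGξ.2⟩
  have hbc : Continuous b.1 ∧ Continuous b.2 := by
    rw [hb]; exact ⟨hw.1.continuous.sub hGζ.1, continuous_const.sub hGζ.2⟩
  have hnc : Continuous (-b).1 ∧ Continuous (-b).2 := ⟨hbc.1.neg, hbc.2.neg⟩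
  rw [← ha] at hvξ ⊢
  rw [← hb] at hwζ ⊢
  have e1 : incl (v + w) = (a + b) + infGauge A r z (ξ + ζ) := by
    rw [infGauge_add A r z hξ hζ, ha, hb, show incl (v + w) = incl v + incl w from rfl]
    abel
  have e2 : incl (v - w) = (a + -b) + infGauge A r z (ξ + -ζ) := by
    rw [infGauge_add A r z hξ (lieGauge_neg hζ), infGauge_neg, ha, hb,
      show incl (v - w) = incl v - incl w from rfl]
    abel
  have hsc : Continuous (a + b).1 ∧ Continuous (a + b).2 := ⟨hac.1.add hbc.1, hac.2.add hbc.2⟩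
  have hdc : Continuous (a + -b).1 ∧ Continuous (a + -b).2 := ⟨hac.1.add hnc.1, hac.2.add hnc.2⟩
  unfold quotientMetric
  rw [e1, e2, quotientLengthSq_eq A r hz hsc (lieGauge_add hξ hζ),
    quotientLengthSq_eq A r hz hdc (lieGauge_add hξ (lieGauge_neg hζ)),
    l2Metric_add_left hac hbc hsc, l2Metric_comm a (a + b), l2Metric_comm b (a + b),
    l2Metric_add_left hac hbc hac, l2Metric_add_left hac hbc hbc,
    l2Metric_add_left hac hnc hdc, l2Metric_comm a (a + -b), l2Metric_neg_left,
    l2Metric_comm b (a + -b), l2Metric_add_left hac hnc hac, l2Metric_add_left hac hnc hbc,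
    l2Metric_neg_left, l2Metric_neg_left, l2Metric_comm b a]
  · ring
  · intro χ hχ
    rw [l2Metric_add_left hac hnc (continuous_infGauge A r hz hχ), l2Metric_neg_left, hvξ χ hχ,
      hwζ χ hχ]
    simp
  · intro χ hχ
    rw [l2Metric_add_left hac hbc (continuous_infGauge A r hz hχ), hvξ χ hχ, hwζ χ hχ]
    simp

end MomentFloer

end

/-! The squared norm `u = ‖z‖²` along a flow line is almost subharmonic on the cylinder, and this is
made quantitative uniformly in `r`. Write `μ = momentMap A z` and `m = meanMoment A z`.

The gradient for `g_r` is found from a horizontal representative. This yields `∂ₛz = -(i(∂ₜz + L_z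
η) + L_z ξ)` and `∂ₛη = -(m - τ)`, where `ξ` has mean zero in `t` and `∂ₜξ = r²(μ - m)`
(`IsGradient.eq`, `IsFlowLine.exists_eq`). This is a perturbed Cauchy–Riemann equation in each
coordinate, and it gives `Δu = 4‖∂ₜz + L_z η‖² + 4⟨μ, m - τ + r²(μ - m)⟩`
(`IsFlowLine.laplacian_norm_sq`).

Averaging over the circle, the `r²` term becomes a variance and is nonnegative, so the mean of `u`
has second derivative at least `4∫‖∂ₜz + L_z η‖² + 4(‖m‖² - ⟨m, τ⟩)`. A proper homogeneous quadratic
`μ` controls `‖z‖²` linearly, and since `μ` is linear in the `‖z j‖²` this passes to means: a large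
mean of `u` forces `‖m‖` to be large, hence strict convexity. Finite energy brings `m` within
distance one of `τ` at times arbitrarily far in both directions, so the one-dimensional maximum
principle bounds the mean of `u` (`IsFlowLine.integral_norm_sq_le`).

To pass from means to points, `m` is now bounded, and `r ≤ 1` gives `Δu ≥ -Du` with `D` independent
of `r`. A bounded function has moderate second derivative somewhere in every interval of fixed
length; at such a time `∫‖∂ₜz + L_z η‖²` is bounded, and so is `u` on that whole circle. A maximum
principle on the short annuli between such circles fills the gaps (`le_of_integral_le`). -/

noncomputable section

namespace MomentFloer

open scoped ContDiff

/-! ### Calculus of two real variables -/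

section Calculus

variable {E : Type*} [NormedAddCommGroup E] [NormedSpace ℝ E]

/-- Differentiation under the integral sign over the unit interval. -/
theorem hasDerivAt_integral_unit {F F' : ℝ → ℝ → E}
    (hF : ∀ s t, HasDerivAt (fun σ => F σ t) (F' s t) s) (hFc : ∀ s, Continuous (F s))
    (hF' : Continuous fun p : ℝ × ℝ => F' p.1 p.2) (s : ℝ) :
    HasDerivAt (fun σ => ∫ t in (0 : ℝ)..1, F σ t) (∫ t in (0 : ℝ)..1, F' s t) s := by
  have hK : IsCompact (Set.Icc (s - 1) (s + 1) ×ˢ Set.Icc (0 : ℝ) 1) :=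
    isCompact_Icc.prod isCompact_Icc
  obtain ⟨C, hC⟩ := hK.exists_bound_of_continuousOn hF'.continuousOn
  have hF's : Continuous (F' s) := hF'.comp (by fun_prop : Continuous fun t : ℝ => (s, t))
  refine (intervalIntegral.hasDerivAt_integral_of_dominated_loc_of_deriv_le
    (bound := fun _ => C) (s := Set.Icc (s - 1) (s + 1)) (Icc_mem_nhds (by linarith) (by linarith))
    (Filter.Eventually.of_forall fun x => (hFc x).aestronglyMeasurable)
    ((hFc s).intervalIntegrable _ _) hF's.aestronglyMeasurable
    (Filter.Eventually.of_forall fun t ht x hx => ?_) (by simp)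
    (Filter.Eventually.of_forall fun t _ x _ => hF x t)).2
  rw [Set.uIoc_of_le zero_le_one] at ht
  exact hC (x, t) ⟨hx, ht.1.le, ht.2⟩

theorem hasDerivAt_fst_of_contDiff {f : ℝ → ℝ → E} (hf : ContDiff ℝ ∞ fun p : ℝ × ℝ => f p.1 p.2)
    (s t : ℝ) : HasDerivAt (fun σ => f σ t)
      (fderiv ℝ (fun p : ℝ × ℝ => f p.1 p.2) (s, t) (1, 0)) s := by
  have h1 := (hf.differentiable (by simp) (s, t)).hasFDerivAt
  exact h1.comp_hasDerivAt (f := fun σ => (σ, t)) s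
    ((hasDerivAt_id s).prodMk (hasDerivAt_const s t))

theorem hasDerivAt_snd_of_contDiff {f : ℝ → ℝ → E} (hf : ContDiff ℝ ∞ fun p : ℝ × ℝ => f p.1 p.2)
    (s t : ℝ) : HasDerivAt (fun σ => f s σ)
      (fderiv ℝ (fun p : ℝ × ℝ => f p.1 p.2) (s, t) (0, 1)) t := by
  have h1 := (hf.differentiable (by simp) (s, t)).hasFDerivAt
  exact h1.comp_hasDerivAt (f := fun σ => (s, σ)) t
    ((hasDerivAt_const t s).prodMk (hasDerivAt_id t))

theorem contDiff_deriv_fst {f : ℝ → ℝ → E} (hf : ContDiff ℝ ∞ fun p : ℝ × ℝ => f p.1 p.2) :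
    ContDiff ℝ ∞ fun p : ℝ × ℝ => deriv (fun σ => f σ p.2) p.1 := by
  have h : (fun p : ℝ × ℝ => deriv (fun σ => f σ p.2) p.1) =
      fun p => fderiv ℝ (fun p : ℝ × ℝ => f p.1 p.2) p (1, 0) :=
    funext fun p => (hasDerivAt_fst_of_contDiff hf p.1 p.2).deriv
  rw [h]
  exact (hf.fderiv_right (by simp)).clm_apply contDiff_const

theorem contDiff_deriv_snd {f : ℝ → ℝ → E} (hf : ContDiff ℝ ∞ fun p : ℝ × ℝ => f p.1 p.2) :
    ContDiff ℝ ∞ fun p : ℝ × ℝ => deriv (f p.1) p.2 := by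
  have h : (fun p : ℝ × ℝ => deriv (f p.1) p.2) =
      fun p => fderiv ℝ (fun p : ℝ × ℝ => f p.1 p.2) p (0, 1) :=
    funext fun p => (hasDerivAt_snd_of_contDiff hf p.1 p.2).deriv
  rw [h]
  exact (hf.fderiv_right (by simp)).clm_apply contDiff_const

theorem hasDerivAt_integral_of_contDiff {f : ℝ → ℝ → E}
    (hf : ContDiff ℝ ∞ fun p : ℝ × ℝ => f p.1 p.2) (s : ℝ) :
    HasDerivAt (fun σ => ∫ t in (0 : ℝ)..1, f σ t)
      (∫ t in (0 : ℝ)..1, deriv (fun σ => f σ t) s) s :=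
  hasDerivAt_integral_unit (F' := fun s t => deriv (fun σ => f σ t) s)
    (fun s t => (hasDerivAt_fst_of_contDiff hf s t).differentiableAt.hasDerivAt)
    (fun s => hf.continuous.comp (by fun_prop : Continuous fun y : ℝ => (s, y)))
    (contDiff_deriv_fst hf).continuous s

theorem hasDerivAt_deriv_integral_of_contDiff {f : ℝ → ℝ → E}
    (hf : ContDiff ℝ ∞ fun p : ℝ × ℝ => f p.1 p.2) (s : ℝ) :
    HasDerivAt (deriv fun σ => ∫ t in (0 : ℝ)..1, f σ t)
      (∫ t in (0 : ℝ)..1, deriv (deriv fun σ => f σ t) s) s := by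
  rw [show (deriv fun σ => ∫ t in (0 : ℝ)..1, f σ t) = fun s =>
    ∫ t in (0 : ℝ)..1, deriv (fun σ => f σ t) s from
      funext fun s => (hasDerivAt_integral_of_contDiff hf s).deriv]
  exact hasDerivAt_integral_of_contDiff (f := fun s t => deriv (fun σ => f σ t) s)
    (contDiff_deriv_fst hf) s

theorem continuous_deriv_deriv_fst {f : ℝ → ℝ → E}
    (hf : ContDiff ℝ ∞ fun p : ℝ × ℝ => f p.1 p.2) (s : ℝ) :
    Continuous fun t => deriv (deriv fun σ => f σ t) s :=
  (contDiff_deriv_fst (f := fun s t => deriv (fun σ => f σ t) s)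
    (contDiff_deriv_fst hf)).continuous.comp (by fun_prop : Continuous fun t : ℝ => (s, t))

/-- Partial derivatives commute. -/
theorem deriv_deriv_comm {f : ℝ → ℝ → E} (hf : ContDiff ℝ ∞ fun p : ℝ × ℝ => f p.1 p.2)
    (s t : ℝ) : deriv (fun σ => deriv (f σ) t) s = deriv (fun y => deriv (fun σ => f σ y) s) t := by
  have hd : Differentiable ℝ (fderiv ℝ fun p : ℝ × ℝ => f p.1 p.2) :=
    (hf.fderiv_right (m := ∞) (by simp)).differentiable (by simp)
  have h2 := (hd (s, t)).hasFDerivAt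
  have e1 : HasDerivAt (fun σ => fderiv ℝ (fun p : ℝ × ℝ => f p.1 p.2) (σ, t) (0, 1))
      (fderiv ℝ (fderiv ℝ fun p : ℝ × ℝ => f p.1 p.2) (s, t) (1, 0) (0, 1)) s :=
    (h2.clm_apply (hasFDerivAt_const (0, 1) _)).comp_hasDerivAt (f := fun σ => (σ, t)) s
      ((hasDerivAt_id s).prodMk (hasDerivAt_const s t)) |>.congr_deriv (by simp)
  have e2 : HasDerivAt (fun y => fderiv ℝ (fun p : ℝ × ℝ => f p.1 p.2) (s, y) (1, 0))
      (fderiv ℝ (fderiv ℝ fun p : ℝ × ℝ => f p.1 p.2) (s, t) (0, 1) (1, 0)) t :=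
    (h2.clm_apply (hasFDerivAt_const (1, 0) _)).comp_hasDerivAt (f := fun y => (s, y)) t
      ((hasDerivAt_const t s).prodMk (hasDerivAt_id t)) |>.congr_deriv (by simp)
  have a1 : (fun σ => deriv (f σ) t) =
      fun σ => fderiv ℝ (fun p : ℝ × ℝ => f p.1 p.2) (σ, t) (0, 1) :=
    funext fun σ => (hasDerivAt_snd_of_contDiff hf σ t).deriv
  have a2 : (fun y => deriv (fun σ => f σ y) s) =
      fun y => fderiv ℝ (fun p : ℝ × ℝ => f p.1 p.2) (s, y) (1, 0) :=
    funext fun y => (hasDerivAt_fst_of_contDiff hf s y).deriv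
  rw [a1, a2, e1.deriv, e2.deriv]
  exact (hf.contDiffAt.isSymmSndFDerivAt (by simpa using (WithTop.coe_le_coe.2 le_top :
    ((2 : ℕ∞) : WithTop ℕ∞) ≤ ∞))) _ _

end Calculus

/-! ### Maximum principles on the line and on the cylinder -/

/-- The second derivative is nonpositive at a local maximum. -/
theorem deriv_deriv_nonpos_of_isLocalMax {f : ℝ → ℝ} {x : ℝ} (hf : ContinuousAt f x)
    (hx : IsLocalMax f x) : deriv (deriv f) x ≤ 0 := by
  -- A positive second derivative would make `x` a local minimum too, so `f` would be constant near
  -- `x` and its second derivative zero.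
  by_contra! h
  have hmin := isLocalMin_of_deriv_deriv_pos h hx.deriv_eq_zero hf
  have hc : f =ᶠ[nhds x] fun _ => f x := by
    filter_upwards [hx, hmin] with y h1 h2 using le_antisymm h1 h2
  have := hc.deriv.deriv_eq
  simp at this
  linarith

/-- A function that is convex wherever it exceeds `C`, and that is at most `C` somewhere near
either end of the line, is at most `C`. -/
theorem le_of_deriv_deriv_pos {m : ℝ → ℝ} (hm : Continuous m) {C : ℝ}
    (hconv : ∀ s, C < m s → 0 < deriv (deriv m) s)
    (hbot : ∀ s, ∃ a < s, m a ≤ C) (htop : ∀ s, ∃ b > s, m b ≤ C) (s : ℝ) : m s ≤ C := by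
  by_contra! h
  obtain ⟨a, ha, hma⟩ := hbot s
  obtain ⟨b, hb, hmb⟩ := htop s
  obtain ⟨x, hx, hmax⟩ := isCompact_Icc.exists_isMaxOn (Set.nonempty_Icc.2 (ha.trans hb).le)
    (hm.continuousOn (s := Set.Icc a b))
  have hmx : C < m x := h.trans_le (hmax ⟨ha.le, hb.le⟩)
  have hxa : a < x := lt_of_le_of_ne hx.1 fun e => by rw [← e] at hmx; linarith
  have hxb : x < b := lt_of_le_of_ne hx.2 fun e => by rw [e] at hmx; linarith
  have := deriv_deriv_nonpos_of_isLocalMax hm.continuousAt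
    (hmax.isLocalMax (Icc_mem_nhds hxa hxb))
  linarith [hconv x hmx]

/-- A function with values in `[0, M]` cannot have a large second derivative throughout an
interval. -/
theorem exists_deriv_deriv_le {m : ℝ → ℝ} (hm : Differentiable ℝ m)
    (hm' : Differentiable ℝ (deriv m)) {M : ℝ} (h0 : ∀ s, 0 ≤ m s) (hM : ∀ s, m s ≤ M)
    (a : ℝ) {l : ℝ} (hl : 0 < l) :
    ∃ s ∈ Set.Icc a (a + l), deriv (deriv m) s ≤ 8 * M / l ^ 2 + 1 := by
  by_contra! h
  -- If the second derivative exceeds `K`, then `m - K s²/2` is convex, and midpoint convexity gives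
  -- `K l²/8 ≤ M`. This threshold makes `K l²/8 = M + l²/8`.
  set K := 8 * M / l ^ 2 + 1 with hK
  have hd : ∀ s, HasDerivAt (fun s => m s - K / 2 * s ^ 2) (deriv m s - K * s) s := fun s =>
    ((hm s).hasDerivAt.sub ((hasDerivAt_pow 2 s).const_mul (K / 2))).congr_deriv (by
      push_cast; ring)
  have hd' : deriv (fun s => m s - K / 2 * s ^ 2) = fun s => deriv m s - K * s :=
    funext fun s => (hd s).deriv
  have hdd : ∀ s, HasDerivAt (fun s => deriv m s - K * s) (deriv (deriv m) s - K) s := fun s =>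
    ((hm' s).hasDerivAt.sub ((hasDerivAt_id s).const_mul K)).congr_deriv (by simp)
  have hconv : ConvexOn ℝ (Set.Icc a (a + l)) fun s => m s - K / 2 * s ^ 2 := by
    refine convexOn_of_deriv2_nonneg (convex_Icc _ _)
      (fun s _ => (hd s).continuousAt.continuousWithinAt)
      (fun s _ => (hd s).differentiableAt.differentiableWithinAt) ?_ ?_
    · rw [hd']
      exact fun s _ => (hdd s).differentiableAt.differentiableWithinAt
    · intro s hs
      rw [Function.iterate_succ, Function.iterate_one, Function.comp_apply, hd', (hdd s).deriv]
      linarith [h s (interior_subset hs)]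
  have hc := hconv.2 (Set.left_mem_Icc.2 (by linarith)) (Set.right_mem_Icc.2 (by linarith))
    (show (0 : ℝ) ≤ 1 / 2 by norm_num) (show (0 : ℝ) ≤ 1 / 2 by norm_num) (by norm_num)
  simp only [smul_eq_mul] at hc
  have h1 := hM a
  have h2 := hM (a + l)
  have h3 := h0 (1 / 2 * a + 1 / 2 * (a + l))
  have hKl : K * l ^ 2 = 8 * M + l ^ 2 := by
    rw [hK]
    field_simp
  nlinarith [pow_pos hl 2]

/-- A Poincaré-type inequality: on the unit interval a function is bounded by its mean plus its
total variation. -/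
theorem norm_le_integral_add_integral {E : Type*} [NormedAddCommGroup E] [NormedSpace ℝ E]
    [CompleteSpace E] {f f' : ℝ → E} (hf : ∀ t, HasDerivAt f (f' t) t) (hf' : Continuous f')
    {t : ℝ} (ht : t ∈ Set.Icc (0 : ℝ) 1) :
    ‖f t‖ ≤ ‖∫ y in (0 : ℝ)..1, f y‖ + ∫ y in (0 : ℝ)..1, ‖f' y‖ := by
  have hc : Continuous f := continuous_iff_continuousAt.2 fun t => (hf t).continuousAt
  have hb : ∀ y ∈ Set.Icc (0 : ℝ) 1, ‖f t - f y‖ ≤ ∫ y in (0 : ℝ)..1, ‖f' y‖ := by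
    intro y hy
    rw [← intervalIntegral.integral_eq_sub_of_hasDerivAt (fun x _ => hf x)
      (hf'.intervalIntegrable y t)]
    refine (intervalIntegral.norm_integral_le_integral_norm_uIoc).trans ?_
    rw [intervalIntegral.integral_of_le zero_le_one]
    refine MeasureTheory.setIntegral_mono_set (hf'.norm.integrableOn_Ioc)
      (Filter.Eventually.of_forall fun _ => norm_nonneg _) (Filter.Eventually.of_forall ?_)
    intro x hx
    exact ⟨(le_min hy.1 ht.1).trans_lt hx.1, hx.2.trans (max_le hy.2 ht.2)⟩
  -- The interval has length one, so integrating the constant `f t` returns it.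
  have h1 : f t = (∫ y in (0 : ℝ)..1, f y) + ∫ y in (0 : ℝ)..1, (f t - f y) := by
    rw [intervalIntegral.integral_sub (by simp) (hc.intervalIntegrable _ _)]
    simp
  calc ‖f t‖ ≤ ‖∫ y in (0 : ℝ)..1, f y‖ + ‖∫ y in (0 : ℝ)..1, (f t - f y)‖ := by
        conv_lhs => rw [h1]
        exact norm_add_le _ _
    _ ≤ _ := by
        gcongr
        have := intervalIntegral.norm_integral_le_of_norm_le_const (a := 0) (b := 1)
          (f := fun y => f t - f y) (C := ∫ y in (0 : ℝ)..1, ‖f' y‖) (fun y hy => hb y (by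
            rw [Set.uIoc_of_le zero_le_one] at hy
            exact ⟨hy.1.le, hy.2⟩))
        simpa using this

/-- Maximum principle on a thin annulus for nonnegative functions with `Δu ≥ -Cu`. -/
theorem le_of_laplacian_ge {u : ℝ → ℝ → ℝ} (hu : ContDiff ℝ ∞ fun p : ℝ × ℝ => u p.1 p.2)
    (hper : ∀ s, Function.Periodic (u s) 1) {C : ℝ} (hC : 0 ≤ C)
    (hlap : ∀ s t, -C * u s t ≤ deriv (deriv fun σ => u σ t) s + deriv (deriv (u s)) t)
    {s₀ s₁ s₂ B : ℝ} (h1 : s₁ ∈ Set.Icc (s₀ - 1 / (C + 1)) s₀)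
    (h2 : s₂ ∈ Set.Icc s₀ (s₀ + 1 / (C + 1))) (hB0 : 0 ≤ B) (hB1 : ∀ t, u s₁ t ≤ B)
    (hB2 : ∀ t, u s₂ t ≤ B) (t₀ : ℝ) : u s₀ t₀ ≤ 2 * B := by
  have hC1 : 0 < C + 1 := by linarith
  -- A strict supersolution: `φ ≤ 2` and `φ'' = -2(C + 1)` give `φ'' + Cφ ≤ -2`, and `φ ≥ 1` within
  -- `1/(C + 1)` of `s₀`. The argument looks at the maximum of `u/φ`.
  obtain ⟨φ, hφ⟩ : ∃ φ : ℝ → ℝ, φ = fun s => 2 - (C + 1) * (s - s₀) ^ 2 := ⟨_, rfl⟩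
  have hφc : Continuous φ := by rw [hφ]; fun_prop
  have hφd : deriv φ = fun s => -(2 * (C + 1) * (s - s₀)) := by
    funext s
    rw [hφ]
    have := (((((hasDerivAt_id s).sub_const s₀).pow 2).const_mul (C + 1)).const_sub 2).deriv
    simp only [id] at this
    refine this.trans ?_
    push_cast
    ring
  have hφdd : ∀ s, HasDerivAt (deriv φ) (-(2 * (C + 1))) s := by
    intro s
    rw [hφd]
    exact ((((hasDerivAt_id s).sub_const s₀).const_mul (2 * (C + 1))).neg).congr_deriv (by simp)
  have hφ2 : ∀ s, φ s ≤ 2 := fun s => by rw [hφ]; nlinarith [sq_nonneg (s - s₀)]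
  have hφ1 : ∀ s ∈ Set.Icc s₁ s₂, 1 ≤ φ s := by
    intro s hs
    have ha : |s - s₀| ≤ 1 / (C + 1) := by
      rw [abs_le]; constructor <;> linarith [hs.1, hs.2, h1.1, h2.2]
    have hb : (s - s₀) ^ 2 ≤ (1 / (C + 1)) ^ 2 := by
      rw [← sq_abs]; gcongr
    have hc : (C + 1) * (1 / (C + 1)) ^ 2 ≤ 1 := by
      rw [show (C + 1) * (1 / (C + 1)) ^ 2 = 1 / (C + 1) by field_simp]
      rw [div_le_one hC1]; linarith
    rw [hφ]
    nlinarith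
  have hK : IsCompact (Set.Icc s₁ s₂ ×ˢ Set.Icc (0 : ℝ) 1) := isCompact_Icc.prod isCompact_Icc
  have huc : Continuous fun p : ℝ × ℝ => u p.1 p.2 := hu.continuous
  have hs₀ : s₀ ∈ Set.Icc s₁ s₂ := ⟨h1.2, h2.1⟩
  have hcont : ContinuousOn (fun p : ℝ × ℝ => u p.1 p.2 / φ p.1)
      (Set.Icc s₁ s₂ ×ˢ Set.Icc (0 : ℝ) 1) :=
    huc.continuousOn.div (hφc.comp continuous_fst).continuousOn fun p hp =>
      (zero_lt_one.trans_le (hφ1 _ hp.1)).ne'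
  obtain ⟨⟨s, t⟩, hp, hmax⟩ := hK.exists_isMaxOn ⟨(s₀, 0), hs₀, by simp⟩ hcont
  set lam := u s t / φ s with hlam
  have hle : ∀ σ ∈ Set.Icc s₁ s₂, ∀ y, u σ y ≤ lam * φ σ := by
    intro σ hσ y
    obtain ⟨y', hy', e⟩ := (hper σ).exists_mem_Ico₀ zero_lt_one y
    have := hmax (show (σ, y') ∈ _ from ⟨hσ, hy'.1, hy'.2.le⟩)
    simp only [Set.mem_ofPred_eq] at this
    rw [div_le_iff₀ (zero_lt_one.trans_le (hφ1 _ hσ))] at this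
    rw [e]
    exact this
  have hφs : 1 ≤ φ s := hφ1 s hp.1
  have heq : u s t = lam * φ s := by rw [hlam]; field_simp
  have hlamB : lam ≤ B := by
    by_contra! hlt
    have hlam0 : 0 < lam := hB0.trans_lt hlt
    -- If `lam > B`, then at the maximum `u = lam φ ≥ lam > B`, so it lies on neither boundary
    -- circle.
    have hne : ∀ σ ∈ Set.Icc s₁ s₂, (∀ y, u σ y ≤ B) → s ≠ σ := by
      rintro σ - hσB rfl
      have := hσB t
      rw [heq] at this
      nlinarith
    have hs1 : s₁ < s := lt_of_le_of_ne hp.1.1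
      (hne s₁ ⟨le_rfl, hp.1.1.trans hp.1.2⟩ hB1).symm
    have hs2 : s < s₂ := lt_of_le_of_ne hp.1.2 (hne s₂ ⟨hp.1.1.trans hp.1.2, le_rfl⟩ hB2)
    have hmt : IsLocalMax (u s) t := Filter.Eventually.of_forall fun y => by
      rw [heq]; exact hle s hp.1 y
    have hms : IsLocalMax (fun σ => u σ t - lam * φ σ) s := by
      filter_upwards [Icc_mem_nhds hs1 hs2] with σ hσ
      rw [heq, sub_self]
      linarith [hle σ hσ t]
    have hus : ∀ σ, DifferentiableAt ℝ (fun σ => u σ t) σ := fun σ =>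
      (hasDerivAt_fst_of_contDiff hu σ t).differentiableAt
    have huss : DifferentiableAt ℝ (deriv fun σ => u σ t) s :=
      (hasDerivAt_fst_of_contDiff (f := fun σ y => deriv (fun σ => u σ y) σ)
        (contDiff_deriv_fst hu) s t).differentiableAt
    have hφdiff : ∀ σ, DifferentiableAt ℝ φ σ := fun σ => by rw [hφ]; fun_prop
    have n1 := deriv_deriv_nonpos_of_isLocalMax (f := u s)
      (huc.comp (by fun_prop : Continuous fun y : ℝ => (s, y))).continuousAt hmt
    have n2 := deriv_deriv_nonpos_of_isLocalMax (f := fun σ => u σ t - lam * φ σ)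
      ((hus s).continuousAt.sub (hφc.continuousAt.const_mul lam)) hms
    have hd1 : deriv (fun σ => u σ t - lam * φ σ) =
        fun σ => deriv (fun σ => u σ t) σ - lam * deriv φ σ := funext fun σ =>
      ((hus σ).hasDerivAt.sub ((hφdiff σ).hasDerivAt.const_mul lam)).deriv
    have hd2 : deriv (fun σ => deriv (fun σ => u σ t) σ - lam * deriv φ σ) s =
        deriv (deriv fun σ => u σ t) s - lam * -(2 * (C + 1)) :=
      (huss.hasDerivAt.sub ((hφdd s).const_mul lam)).deriv
    -- At the interior maximum `Δu ≤ lam φ'' = -2(C + 1) lam`, whereas the hypothesis gives `Δu ≥ -C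
    -- lam φ ≥ -2C lam`.
    rw [hd1, hd2] at n2
    have h3 := hlap s t
    rw [heq] at h3
    nlinarith [hφ2 s, mul_nonneg hC hlam0.le]
  have := hle s₀ hs₀ t₀
  nlinarith [hφ2 s₀, hφ1 s₀ hs₀]

/-- A priori sup bound on a cylinder: if `u ≥ 0` satisfies `Δu ≥ -Cu` pointwise and
`∫ Δu ≥ 4 ∫ D - L` with `|∂ₜu| ≤ u + D`, then a bound on the means of `u` over circles bounds
`u`. -/
theorem le_of_integral_le {M C L : ℝ} (hC : 0 ≤ C) {u D : ℝ → ℝ → ℝ}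
    (hu : ContDiff ℝ ∞ fun p : ℝ × ℝ => u p.1 p.2) (hper : ∀ s, Function.Periodic (u s) 1)
    (hu0 : ∀ s t, 0 ≤ u s t) (hD : ∀ s, Continuous (D s))
    (hM : ∀ s, ∫ t in (0 : ℝ)..1, u s t ≤ M)
    (hlap : ∀ s t, -C * u s t ≤ deriv (deriv fun σ => u σ t) s + deriv (deriv (u s)) t)
    (hmean : ∀ s, 4 * (∫ t in (0 : ℝ)..1, D s t) - L ≤
      deriv (deriv fun σ => ∫ t in (0 : ℝ)..1, u σ t) s)
    (hut : ∀ s t, |deriv (u s) t| ≤ u s t + D s t) (s t : ℝ) :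
    u s t ≤ 2 * (2 * M + (8 * M * (C + 1) ^ 2 + 1 + L) / 4) := by
  have hl : 0 < 1 / (C + 1) := by positivity
  have hus : ∀ s, Continuous (u s) := fun s =>
    hu.continuous.comp (by fun_prop : Continuous fun y : ℝ => (s, y))
  have hm := hasDerivAt_integral_of_contDiff hu
  have hm' := hasDerivAt_deriv_integral_of_contDiff hu
  have hm0 : ∀ s, 0 ≤ ∫ t in (0 : ℝ)..1, u s t := fun s =>
    intervalIntegral.integral_nonneg zero_le_one fun t _ => hu0 s t
  -- Every window of length `1/(C + 1)` contains a time where the mean of `u` has second derivative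
  -- at most `8M(C + 1)² + 1`. There `hmean` bounds `∫ D`, hence the total variation of `u` on that
  -- circle, hence `u` itself.
  have good : ∀ a, ∃ σ ∈ Set.Icc a (a + 1 / (C + 1)), ∀ y,
      u σ y ≤ 2 * M + (8 * M * (C + 1) ^ 2 + 1 + L) / 4 := by
    intro a
    obtain ⟨σ, hσ, hle⟩ := exists_deriv_deriv_le (fun s => (hm s).differentiableAt)
      (fun s => (hm' s).differentiableAt) hm0 hM a hl
    refine ⟨σ, hσ, fun y => ?_⟩
    obtain ⟨y', hy', e⟩ := (hper σ).exists_mem_Ico₀ zero_lt_one y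
    have hdc : Continuous (deriv (u σ)) :=
      (contDiff_deriv_snd hu).continuous.comp (by fun_prop : Continuous fun y : ℝ => (σ, y))
    have h1 := norm_le_integral_add_integral
      (fun t => (hasDerivAt_snd_of_contDiff hu σ t).differentiableAt.hasDerivAt) hdc
      (Set.Ico_subset_Icc_self hy')
    rw [Real.norm_of_nonneg (hu0 _ _), Real.norm_of_nonneg (hm0 _)] at h1
    have h2 : (∫ y in (0 : ℝ)..1, ‖deriv (u σ) y‖) ≤
        (∫ y in (0 : ℝ)..1, u σ y) + ∫ y in (0 : ℝ)..1, D σ y := by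
      rw [← intervalIntegral.integral_add ((hus σ).intervalIntegrable _ _)
        ((hD σ).intervalIntegrable _ _)]
      exact intervalIntegral.integral_mono_on zero_le_one (hdc.norm.intervalIntegrable _ _)
        (((hus σ).add (hD σ)).intervalIntegrable _ _) fun y _ => hut σ y
    have h3 := hmean σ
    have h4 : 8 * M / (1 / (C + 1)) ^ 2 = 8 * M * (C + 1) ^ 2 := by field_simp
    rw [e]
    linarith [hM σ]
  obtain ⟨s₁, hs₁, hB1⟩ := good (s - 1 / (C + 1))
  obtain ⟨s₂, hs₂, hB2⟩ := good s
  rw [sub_add_cancel] at hs₁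
  exact le_of_laplacian_ge hu hper hC hlap hs₁ hs₂ ((hu0 s₁ 0).trans (hB1 0)) hB1 hB2 t

variable {n k : ℕ}

/-! ### The gradient of the action functional -/

theorem weight_add (A : Matrix (Fin n) (Fin k) ℤ) (ξ ζ : TorusLie k) (j : Fin n) :
    weight A (ξ + ζ) j = weight A ξ j + weight A ζ j := by
  simp [weight, mul_add, Finset.sum_add_distrib]

theorem weight_smul (A : Matrix (Fin n) (Fin k) ℤ) (c : ℝ) (ξ : TorusLie k) (j : Fin n) :
    weight A (c • ξ) j = c * weight A ξ j := by
  simp only [weight, PiLp.smul_apply, smul_eq_mul, Finset.mul_sum]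
  exact Finset.sum_congr rfl fun l _ => by ring

theorem contDiff_weight (A : Matrix (Fin n) (Fin k) ℤ) (j : Fin n) :
    ContDiff ℝ ∞ fun ξ => weight A ξ j := by
  unfold weight
  fun_prop

theorem contDiff_momentMap (A : Matrix (Fin n) (Fin k) ℤ) : ContDiff ℝ ∞ (momentMap A) := by
  refine contDiff_euclidean.2 fun l => ?_
  simp only [momentMap]
  refine contDiff_const.mul (ContDiff.sum fun j _ => contDiff_const.mul ?_)
  have : ContDiff ℝ ∞ fun z : CSpace n => z j := by fun_prop
  exact this.norm_sq ℝ

theorem contDiff_infAction (A : Matrix (Fin n) (Fin k) ℤ) :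
    ContDiff ℝ ∞ fun p : CSpace n × TorusLie k => infAction A p.1 p.2 := by
  have : ContDiff ℝ ∞ fun p : CSpace n × TorusLie k => fun j =>
      Complex.I * (weight A p.2 j : ℂ) * p.1 j := by
    refine contDiff_pi.2 fun j => ?_
    have h1 : ContDiff ℝ ∞ fun p : CSpace n × TorusLie k => ((weight A p.2 j : ℝ) : ℂ) :=
      Complex.ofRealCLM.contDiff.comp ((contDiff_weight A j).comp contDiff_snd)
    have h2 : ContDiff ℝ ∞ fun p : CSpace n × TorusLie k => p.1 j := by fun_prop
    exact (contDiff_const.mul h1).mul h2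
  exact (PiLp.continuousLinearEquiv 2 ℝ (fun _ : Fin n => ℂ)).symm.contDiff.comp this

/-- The derivative of the moment map at `z` in the direction `w`. -/
def momentDeriv (A : Matrix (Fin n) (Fin k) ℤ) (z w : CSpace n) : TorusLie k :=
  WithLp.toLp 2 fun l =>
    -∑ j, (A j l : ℝ) * ((z j).re * (w j).re + (z j).im * (w j).im)

theorem continuous_momentDeriv (A : Matrix (Fin n) (Fin k) ℤ) :
    Continuous fun p : CSpace n × CSpace n => momentDeriv A p.1 p.2 := by
  unfold momentDeriv
  fun_prop

theorem hasDerivAt_complex_re {f : ℝ → ℂ} {f' : ℂ} {t : ℝ} (hf : HasDerivAt f f' t) :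
    HasDerivAt (fun t => (f t).re) f'.re t :=
  Complex.reCLM.hasFDerivAt.comp_hasDerivAt t hf

theorem hasDerivAt_complex_im {f : ℝ → ℂ} {f' : ℂ} {t : ℝ} (hf : HasDerivAt f f' t) :
    HasDerivAt (fun t => (f t).im) f'.im t :=
  Complex.imCLM.hasFDerivAt.comp_hasDerivAt t hf

theorem hasDerivAt_coord {z : ℝ → CSpace n} {z' : CSpace n} {t : ℝ} (hz : HasDerivAt z z' t)
    (j : Fin n) : HasDerivAt (fun t => z t j) (z' j) t :=
  (PiLp.proj 2 (𝕜 := ℝ) (fun _ : Fin n => ℂ) j).hasFDerivAt.comp_hasDerivAt t hz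

theorem hasDerivAt_momentMap (A : Matrix (Fin n) (Fin k) ℤ) {z : ℝ → CSpace n} {z' : CSpace n}
    {t : ℝ} (hz : HasDerivAt z z' t) :
    HasDerivAt (fun t => momentMap A (z t)) (momentDeriv A (z t) z') t := by
  refine ((PiLp.continuousLinearEquiv 2 ℝ
    (fun _ : Fin k => ℝ)).symm.hasFDerivAt).comp_hasDerivAt t (hasDerivAt_pi.2 fun l => ?_)
  have h : ∀ j, HasDerivAt (fun t => ‖z t j‖ ^ 2)
      (2 * ((z t j).re * (z' j).re + (z t j).im * (z' j).im)) t := by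
    intro j
    have h1 := hasDerivAt_complex_re (hasDerivAt_coord hz j)
    have h2 := hasDerivAt_complex_im (hasDerivAt_coord hz j)
    simp only [Complex.sq_norm, Complex.normSq_apply]
    exact ((h1.mul h1).add (h2.mul h2)).congr_deriv (by ring)
  refine ((HasDerivAt.fun_sum fun j _ => (h j).const_mul (A j l : ℝ)).const_mul
    (-(1 / 2 : ℝ))).congr_deriv ?_
  rw [Finset.mul_sum, ← Finset.sum_neg_distrib]
  exact Finset.sum_congr rfl fun j _ => by ring

/-- The moment map identity `d⟨μ, ξ⟩ = ω(L_z ξ, ·)`; it serves both the first variation of the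
action and the orthogonality of its gradient to gauge orbits. -/
theorem inner_momentDeriv (A : Matrix (Fin n) (Fin k) ℤ) (z w : CSpace n) (ξ : TorusLie k) :
    inner ℝ (momentDeriv A z w) ξ = symplecticForm (infAction A z ξ) w := by
  simp only [momentDeriv, symplecticForm, infAction, weight, PiLp.inner_apply, RCLike.inner_apply,
    conj_trivial, Finset.mul_sum, ← Finset.sum_neg_distrib]
  rw [Finset.sum_comm]
  refine Finset.sum_congr rfl fun j _ => ?_
  simp only [Complex.mul_re, Complex.mul_im, Complex.I_re, Complex.I_im, Complex.ofReal_re,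
    Complex.ofReal_im]
  simp only [zero_mul, one_mul, mul_zero, sub_zero, zero_sub, zero_add, Finset.sum_mul,
    ← Finset.sum_neg_distrib, ← Finset.sum_sub_distrib]
  exact Finset.sum_congr rfl fun l _ => by ring

/-- Compatibility of the metric, the complex structure and `ω`; it is why the gradient carries the
factor `i`. -/
theorem re_inner_I_smul (v w : CSpace n) :
    (inner ℂ (Complex.I • v) w).re = symplecticForm v w := by
  simp only [symplecticForm, PiLp.inner_apply, RCLike.inner_apply, Complex.re_sum]
  refine Finset.sum_congr rfl fun j _ => ?_
  simp
  ring

theorem symplecticForm_add_left (u v w : CSpace n) :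
    symplecticForm (u + v) w = symplecticForm u w + symplecticForm v w := by
  simp only [symplecticForm, ← Finset.sum_add_distrib]
  refine Finset.sum_congr rfl fun j _ => ?_
  simp
  ring

theorem symplecticForm_swap (v w : CSpace n) : symplecticForm v w = -symplecticForm w v := by
  simp only [symplecticForm, ← Finset.sum_neg_distrib]
  exact Finset.sum_congr rfl fun j _ => by ring

/-- Torus orbits are isotropic: in each coordinate both vectors are real multiples of `i z j`. -/
theorem symplecticForm_infAction (A : Matrix (Fin n) (Fin k) ℤ) (z : CSpace n)
    (ξ ζ : TorusLie k) : symplecticForm (infAction A z ξ) (infAction A z ζ) = 0 := by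
  refine Finset.sum_eq_zero fun j _ => ?_
  simp [infAction]
  ring

theorem periodic_deriv {E : Type*} [NormedAddCommGroup E] [NormedSpace ℝ E] {f : ℝ → E}
    (hf : Function.Periodic f 1) : Function.Periodic (deriv f) 1 := fun t => by
  rw [← deriv_comp_add_const, show (fun x => f (x + 1)) = f from funext hf]

theorem IsSmoothLoop.deriv {E : Type*} [NormedAddCommGroup E] [NormedSpace ℝ E] {f : ℝ → E}
    (hf : IsSmoothLoop f) : IsSmoothLoop (deriv f) :=
  ⟨(contDiff_infty_iff_deriv.1 hf.1).2, periodic_deriv hf.2⟩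

theorem IsSmoothLoop.hasDerivAt {E : Type*} [NormedAddCommGroup E] [NormedSpace ℝ E] {f : ℝ → E}
    (hf : IsSmoothLoop f) (t : ℝ) : HasDerivAt f (_root_.deriv f t) t :=
  (hf.1.differentiable (by simp) t).hasDerivAt

/-- The derivative of a periodic function integrates to zero over a period. -/
theorem integral_eq_zero_of_periodic {E : Type*} [NormedAddCommGroup E] [NormedSpace ℝ E]
    [CompleteSpace E] {f f' : ℝ → E} (hf : ∀ t, HasDerivAt f (f' t) t) (hf' : Continuous f')
    (hper : Function.Periodic f 1) : ∫ t in (0 : ℝ)..1, f' t = 0 := by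
  rw [intervalIntegral.integral_eq_sub_of_hasDerivAt (fun x _ => hf x)
    (hf'.intervalIntegrable 0 1), sub_eq_zero]
  simpa using hper 0

/-- A smooth loop of mean zero has a primitive in the Lie algebra of the gauge group. -/
theorem exists_mem_lieGauge_hasDerivAt {φ : ℝ → TorusLie k} (hφ : IsSmoothLoop φ)
    (h0 : ∫ t in (0 : ℝ)..1, φ t = 0) : ∃ ξ ∈ lieGauge k, ∀ t, HasDerivAt ξ (φ t) t := by
  have hd : ∀ t, HasDerivAt (fun t => ∫ y in (0 : ℝ)..t, φ y) (φ t) t := fun t =>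
    intervalIntegral.integral_hasDerivAt_right (hφ.1.continuous.intervalIntegrable _ _)
      (hφ.1.continuous.stronglyMeasurableAtFilter _ _) hφ.1.continuous.continuousAt
  -- Subtracting this constant normalizes the primitive to mean zero.
  set c : TorusLie k := ∫ t in (0 : ℝ)..1, ∫ y in (0 : ℝ)..t, φ y with hc
  have hd' : ∀ t, HasDerivAt (fun t => (∫ y in (0 : ℝ)..t, φ y) - c) (φ t) t := fun t =>
    (hd t).sub_const c
  have hcont : Continuous fun t => ∫ y in (0 : ℝ)..t, φ y :=
    continuous_iff_continuousAt.2 fun t => (hd t).continuousAt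
  refine ⟨fun t => (∫ y in (0 : ℝ)..t, φ y) - c, ⟨⟨?_, fun t => ?_⟩, ?_⟩, hd'⟩
  · refine contDiff_infty_iff_deriv.2 ⟨fun t => (hd' t).differentiableAt, ?_⟩
    rw [show _root_.deriv (fun t => (∫ y in (0 : ℝ)..t, φ y) - c) = φ from
      funext fun t => (hd' t).deriv]
    exact hφ.1
  · have h1 := hφ.2.intervalIntegral_add_eq t 0
    rw [zero_add, h0] at h1
    have h2 := intervalIntegral.integral_add_adjacent_intervals
      (hφ.1.continuous.intervalIntegrable (μ := MeasureTheory.volume) 0 t)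
      (hφ.1.continuous.intervalIntegrable t (t + 1))
    simp only
    rw [← h2, h1, add_zero]
  · rw [intervalIntegral.integral_sub (hcont.intervalIntegrable _ _) (by simp)]
    simp [hc]

/-- The first variation of the action functional. -/
theorem hasDerivAt_action₀ (A : Matrix (Fin n) (Fin k) ℤ) (τ : TorusLie k) {z : ℝ → CSpace n}
    (hz : IsSmoothLoop z) (η : TorusLie k) {w : (ℝ → CSpace n) × TorusLie k}
    (hw : IsSmoothLoop w.1) :
    HasDerivAt (fun ε : ℝ => action₀ A τ ((z, η) + ε • w))
      (l2Metric (fun t => Complex.I • (deriv z t + infAction A (z t) η),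
        fun t => momentMap A (z t) - τ) (incl w)) 0 := by
  obtain ⟨w, v⟩ := w
  simp only at hw
  have hzc := hz.1.continuous
  have hwc := hw.1.continuous
  have hz'c := hz.deriv.1.continuous
  have hw'c := hw.deriv.1.continuous
  have hμc := (contDiff_momentMap A).continuous
  have hdc := continuous_momentDeriv A
  have h1 := hasDerivAt_integral_unit
    (F := fun ε t => ∑ j, ((z t j).im + ε * (w t j).im) *
      ((deriv z t j).re + ε * (deriv w t j).re))
    (F' := fun ε t => ∑ j, ((w t j).im * ((deriv z t j).re + ε * (deriv w t j).re) +
      ((z t j).im + ε * (w t j).im) * (deriv w t j).re))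
    (fun ε t => HasDerivAt.fun_sum fun j _ => by
      have a1 : HasDerivAt (fun ε : ℝ => (z t j).im + ε * (w t j).im) (w t j).im ε := by
        simpa using ((hasDerivAt_id ε).mul_const (w t j).im).const_add (z t j).im
      have a2 : HasDerivAt (fun ε : ℝ => (deriv z t j).re + ε * (deriv w t j).re)
          (deriv w t j).re ε := by
        simpa using ((hasDerivAt_id ε).mul_const (deriv w t j).re).const_add (deriv z t j).re
      exact a1.mul a2)
    (fun ε => by fun_prop) (by fun_prop) 0
  have h2 := hasDerivAt_integral_unit
    (F := fun ε t => inner ℝ (momentMap A (z t + ε • w t) - τ) (η + ε • v))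
    (F' := fun ε t => inner ℝ (momentMap A (z t + ε • w t) - τ) v +
      inner ℝ (momentDeriv A (z t + ε • w t) (w t)) (η + ε • v))
    (fun ε t => by
      have a1 : HasDerivAt (fun ε : ℝ => z t + ε • w t) (w t) ε := by
        simpa using ((hasDerivAt_id ε).smul_const (w t)).const_add (z t)
      have a2 : HasDerivAt (fun ε : ℝ => η + ε • v) v ε := by
        simpa using ((hasDerivAt_id ε).smul_const v).const_add η
      exact ((hasDerivAt_momentMap A a1).sub_const τ).inner ℝ a2)
    (fun ε => by fun_prop) (by
      have : Continuous fun p : ℝ × ℝ => momentDeriv A (z p.2 + p.1 • w p.2) (w p.2) :=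
        hdc.comp (by fun_prop : Continuous fun p : ℝ × ℝ => (z p.2 + p.1 • w p.2, w p.2))
      fun_prop) 0
  have hd : ∀ (ε t : ℝ), deriv (z + ε • w) t = deriv z t + ε • deriv w t := fun ε t =>
    ((hz.hasDerivAt t).add ((hw.hasDerivAt t).const_smul ε)).deriv
  have hfun : (fun ε : ℝ => action₀ A τ ((z, η) + ε • (w, v))) = fun ε =>
      (∫ t in (0 : ℝ)..1, ∑ j, ((z t j).im + ε * (w t j).im) *
        ((deriv z t j).re + ε * (deriv w t j).re)) +
      ∫ t in (0 : ℝ)..1, inner ℝ (momentMap A (z t + ε • w t) - τ) (η + ε • v) := by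
    funext ε
    simp only [action₀, action, incl, Prod.fst_add, Prod.snd_add, Prod.smul_fst, Prod.smul_snd, hd]
    simp
  rw [hfun]
  refine (h1.add h2).congr_deriv ?_
  -- Integration by parts on the circle: subtracting this vanishing integral turns the variation of
  -- `∫ y dx` into `∫ ω(∂ₜz, w)`.
  have hparts : ∫ t in (0 : ℝ)..1, ∑ j, ((deriv z t j).im * (w t j).re +
      (z t j).im * (deriv w t j).re) = 0 :=
    integral_eq_zero_of_periodic (f := fun t => ∑ j, (z t j).im * (w t j).re)
      (fun t => HasDerivAt.fun_sum fun j _ =>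
        (hasDerivAt_complex_im (hasDerivAt_coord (hz.hasDerivAt t) j)).mul
          (hasDerivAt_complex_re (hasDerivAt_coord (hw.hasDerivAt t) j)))
      (by fun_prop) (fun t => by simp [hz.2 t, hw.2 t])
  have hLz : Continuous fun t => momentDeriv A (z t) (w t) :=
    hdc.comp (by fun_prop : Continuous fun t => (z t, w t))
  simp only [zero_mul, add_zero, zero_smul]
  refine ((congrArg (_ - ·) hparts).trans (sub_zero _)).symm.trans ?_
  rw [← intervalIntegral.integral_add (Continuous.intervalIntegrable (by fun_prop) _ _)
      (Continuous.intervalIntegrable (by fun_prop) _ _),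
    ← intervalIntegral.integral_sub (Continuous.intervalIntegrable (by fun_prop) _ _)
      (Continuous.intervalIntegrable (by fun_prop) _ _)]
  refine intervalIntegral.integral_congr fun t _ => ?_
  simp only [incl]
  rw [re_inner_I_smul, symplecticForm_add_left, inner_momentDeriv, add_comm (inner ℝ _ v),
    ← add_assoc, add_sub_right_comm, add_sub_right_comm, ← Finset.sum_sub_distrib]
  congr 2
  exact Finset.sum_congr rfl fun j _ => by ring

/-! ### Definiteness of the quotient metric and its horizontal gradient -/

theorem l2Metric_add_self {a b : (ℝ → CSpace n) × (ℝ → TorusLie k)}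
    (ha : Continuous a.1 ∧ Continuous a.2) (hb : Continuous b.1 ∧ Continuous b.2) :
    l2Metric (a + b) (a + b) = l2Metric a a + 2 * l2Metric a b + l2Metric b b := by
  have hab : Continuous (a + b).1 ∧ Continuous (a + b).2 := ⟨ha.1.add hb.1, ha.2.add hb.2⟩
  rw [l2Metric_add_left ha hb hab, l2Metric_comm a (a + b), l2Metric_comm b (a + b),
    l2Metric_add_left ha hb ha, l2Metric_add_left ha hb hb, l2Metric_comm b a]
  ring

theorem l2Metric_self_eq {a : (ℝ → CSpace n) × (ℝ → TorusLie k)}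
    (ha : Continuous a.1 ∧ Continuous a.2) :
    l2Metric a a = (∫ t in (0 : ℝ)..1, ‖a.1 t‖ ^ 2) + ∫ t in (0 : ℝ)..1, ‖a.2 t‖ ^ 2 := by
  obtain ⟨h1, h2⟩ := ha
  rw [← intervalIntegral.integral_add (Continuous.intervalIntegrable (by fun_prop) _ _)
      (Continuous.intervalIntegrable (by fun_prop) _ _)]
  refine intervalIntegral.integral_congr fun t _ => ?_
  rw [real_inner_self_eq_norm_sq, ← inner_self_eq_norm_sq (𝕜 := ℂ) (a.1 t)]
  rfl

theorem integral_inner_const_right {f : ℝ → TorusLie k} (hf : Continuous f) (c : TorusLie k) :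
    ∫ t in (0 : ℝ)..1, inner ℝ (f t) c = inner ℝ (∫ t in (0 : ℝ)..1, f t) c := by
  have := (innerSL ℝ c).intervalIntegral_comp_comm
    (hf.intervalIntegrable (μ := MeasureTheory.volume) 0 1)
  simp only [innerSL_apply_apply] at this
  rw [real_inner_comm, ← this]
  exact intervalIntegral.integral_congr fun t _ => real_inner_comm _ _

/-- Jensen's inequality for the square on the unit interval. -/
theorem sq_integral_le {f : ℝ → ℝ} (hf : Continuous f) :
    (∫ t in (0 : ℝ)..1, f t) ^ 2 ≤ ∫ t in (0 : ℝ)..1, f t ^ 2 := by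
  set c := ∫ t in (0 : ℝ)..1, f t with hc
  have h : 0 ≤ ∫ t in (0 : ℝ)..1, (f t - c) ^ 2 :=
    intervalIntegral.integral_nonneg zero_le_one fun t _ => sq_nonneg _
  have e : ∫ t in (0 : ℝ)..1, (f t - c) ^ 2 =
      (∫ t in (0 : ℝ)..1, f t ^ 2) - 2 * c * c + c ^ 2 := by
    have e1 : ∀ t, (f t - c) ^ 2 = f t ^ 2 - 2 * c * f t + c ^ 2 := fun t => by ring
    simp only [e1]
    rw [intervalIntegral.integral_add (Continuous.intervalIntegrable (by fun_prop) _ _) (by simp),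
      intervalIntegral.integral_sub (Continuous.intervalIntegrable (by fun_prop) _ _)
        (Continuous.intervalIntegrable (by fun_prop) _ _),
      intervalIntegral.integral_const_mul, ← hc]
    simp
  nlinarith

theorem exists_abs_weight_le (A : Matrix (Fin n) (Fin k) ℤ) :
    ∃ C, 0 ≤ C ∧ ∀ ξ j, |weight A ξ j| ≤ C * ‖ξ‖ := by
  refine ⟨∑ j, ∑ l, |(A j l : ℝ)|, by positivity, fun ξ j => ?_⟩
  calc |weight A ξ j| ≤ ∑ l, |(A j l : ℝ) * ξ l| := Finset.abs_sum_le_sum_abs _ _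
    _ ≤ ∑ l, |(A j l : ℝ)| * ‖ξ‖ := Finset.sum_le_sum fun l _ => by
        rw [abs_mul]
        gcongr
        exact PiLp.norm_apply_le ξ l
    _ = (∑ l, |(A j l : ℝ)|) * ‖ξ‖ := by rw [Finset.sum_mul]
    _ ≤ _ := by
        gcongr
        exact Finset.single_le_sum (f := fun j => ∑ l, |(A j l : ℝ)|)
          (fun _ _ => by positivity) (Finset.mem_univ j)

/-- The infinitesimal action is bounded linear in `ξ`, uniformly for `z` in a bounded set. -/
theorem exists_norm_infAction_le (A : Matrix (Fin n) (Fin k) ℤ) :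
    ∃ C, 0 ≤ C ∧ ∀ z ξ, ‖infAction A z ξ‖ ≤ C * ‖z‖ * ‖ξ‖ := by
  obtain ⟨C, hC0, hC⟩ := exists_abs_weight_le A
  refine ⟨C, hC0, fun z ξ => abs_le_of_sq_le_sq' ?_ (by positivity) |>.2⟩
  rw [EuclideanSpace.norm_sq_eq, mul_right_comm, mul_pow, EuclideanSpace.norm_sq_eq z,
    Finset.mul_sum]
  refine Finset.sum_le_sum fun j _ => ?_
  have : ‖infAction A z ξ j‖ = |weight A ξ j| * ‖z j‖ := by simp [infAction]
  rw [this, mul_pow]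
  gcongr
  exact hC ξ j

/-- The quotient metric is positive definite on the tangent spaces of `ℒ₀`: no nonzero vector of
`ℒ₀` is an `L²`-limit of vectors tangent to the gauge orbit. -/
theorem eq_zero_of_forall_exists_l2Metric_lt (A : Matrix (Fin n) (Fin k) ℤ) {r : ℝ} (hr : 0 < r)
    {z : ℝ → CSpace n} (hz : IsSmoothLoop z) {w : (ℝ → CSpace n) × TorusLie k}
    (hw : IsSmoothLoop w.1)
    (h : ∀ ε > 0, ∃ χ ∈ lieGauge k,
      l2Metric (incl w - infGauge A r z χ) (incl w - infGauge A r z χ) < ε) : w = 0 := by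
  obtain ⟨w, v⟩ := w
  simp only at hw
  have hwc := hw.1.continuous
  obtain ⟨C, hC0, hC⟩ := exists_norm_infAction_le A
  obtain ⟨R, hR⟩ := isCompact_Icc.exists_bound_of_continuousOn
    (hz.1.continuous.continuousOn (s := Set.Icc (0 : ℝ) 1))
  have key : ∀ ε > 0, ‖v‖ ^ 2 < ε ∧
      ∫ t in (0 : ℝ)..1, ‖w t‖ ^ 2 ≤ (2 + 2 * (C * R) ^ 2 * r ^ 2) * ε := by
    intro ε hε
    obtain ⟨χ, hχ, hlt⟩ := h ε hε
    have hG := continuous_infGauge A r hz hχ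
    have hχ'c := hχ.1.deriv.1.continuous
    have hχc := hχ.1.1.continuous
    have hLc : Continuous fun t => infAction A (z t) (χ t) := hG.1
    rw [l2Metric_self_eq ⟨hw.1.continuous.sub hG.1, continuous_const.sub hG.2⟩] at hlt
    have e1 : (fun t => ‖(incl (w, v) - infGauge A r z χ).1 t‖ ^ 2) =
        fun t => ‖w t - infAction A (z t) (χ t)‖ ^ 2 := rfl
    have e2 : (fun t => ‖(incl (w, v) - infGauge A r z χ).2 t‖ ^ 2) =
        fun t => ‖v‖ ^ 2 + 2 * (1 / r) * inner ℝ v (deriv χ t) +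
          (1 / r) ^ 2 * ‖deriv χ t‖ ^ 2 := by
      funext t
      simp only [incl, infGauge, Prod.snd_sub, Pi.sub_apply, sub_neg_eq_add]
      rw [norm_add_sq_real, inner_smul_right, norm_smul, mul_pow, Real.norm_eq_abs, sq_abs]
      ring
    have hmean : ∫ t in (0 : ℝ)..1, deriv χ t = 0 :=
      integral_eq_zero_of_periodic hχ.1.hasDerivAt hχ'c hχ.1.2
    -- The constant `v` is orthogonal to `deriv χ`, which has mean zero, so the two cannot cancel
    -- and each is small on its own.
    have e3 : (∫ t in (0 : ℝ)..1, ‖(incl (w, v) - infGauge A r z χ).2 t‖ ^ 2) =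
        ‖v‖ ^ 2 + (1 / r) ^ 2 * ∫ t in (0 : ℝ)..1, ‖deriv χ t‖ ^ 2 := by
      rw [e2, intervalIntegral.integral_add (Continuous.intervalIntegrable (by fun_prop) _ _)
          (Continuous.intervalIntegrable (by fun_prop) _ _),
        intervalIntegral.integral_add (by simp)
          (Continuous.intervalIntegrable (by fun_prop) _ _),
        intervalIntegral.integral_const_mul, intervalIntegral.integral_const_mul]
      have : ∫ t in (0 : ℝ)..1, inner ℝ v (deriv χ t) = 0 := by
        simp only [real_inner_comm _ v]
        rw [integral_inner_const_right hχ'c, hmean, inner_zero_left]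
      rw [this]
      simp
    rw [e1, e3] at hlt
    have i1 : 0 ≤ ∫ t in (0 : ℝ)..1, ‖w t - infAction A (z t) (χ t)‖ ^ 2 :=
      intervalIntegral.integral_nonneg zero_le_one fun t _ => by positivity
    have i2 : 0 ≤ ∫ t in (0 : ℝ)..1, ‖deriv χ t‖ ^ 2 :=
      intervalIntegral.integral_nonneg zero_le_one fun t _ => by positivity
    have i3 : (1 / r) ^ 2 * (∫ t in (0 : ℝ)..1, ‖deriv χ t‖ ^ 2) ≤ ε := by
      nlinarith [sq_nonneg ‖v‖]
    have i4 : ∫ t in (0 : ℝ)..1, ‖deriv χ t‖ ^ 2 ≤ r ^ 2 * ε := by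
      rw [div_pow, one_pow, one_div, inv_mul_le_iff₀ (by positivity)] at i3
      exact i3
    refine ⟨by nlinarith [mul_nonneg (sq_nonneg (1 / r)) i2], ?_⟩
    have hb : ∀ t ∈ Set.Icc (0 : ℝ) 1, ‖w t‖ ^ 2 ≤
        2 * ‖w t - infAction A (z t) (χ t)‖ ^ 2 + 2 * (C * R) ^ 2 * (r ^ 2 * ε) := by
      intro t ht
      -- Since `χ` has mean zero, its sup norm is controlled by its derivative; the gauge direction
      -- is then small in the first component, and so is `w`.
      have p1 : ‖χ t‖ ^ 2 ≤ r ^ 2 * ε := by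
        have := norm_le_integral_add_integral hχ.1.hasDerivAt hχ'c ht
        rw [hχ.2, norm_zero, zero_add] at this
        calc ‖χ t‖ ^ 2 ≤ (∫ t in (0 : ℝ)..1, ‖deriv χ t‖) ^ 2 := by gcongr
          _ ≤ _ := (sq_integral_le hχ'c.norm).trans i4
      have p2 : ‖infAction A (z t) (χ t)‖ ^ 2 ≤ (C * R) ^ 2 * (r ^ 2 * ε) := by
        calc ‖infAction A (z t) (χ t)‖ ^ 2 ≤ (C * R * ‖χ t‖) ^ 2 := by
              gcongr
              refine (hC _ _).trans ?_
              gcongr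
              exact hR t ht
          _ = (C * R) ^ 2 * ‖χ t‖ ^ 2 := by ring
          _ ≤ _ := by gcongr
      have p3 : ‖w t‖ ≤ ‖w t - infAction A (z t) (χ t)‖ + ‖infAction A (z t) (χ t)‖ := by
        simpa using norm_add_le (w t - infAction A (z t) (χ t)) (infAction A (z t) (χ t))
      have p4 : ‖w t‖ ^ 2 ≤
          (‖w t - infAction A (z t) (χ t)‖ + ‖infAction A (z t) (χ t)‖) ^ 2 := by gcongr
      nlinarith [sq_nonneg (‖w t - infAction A (z t) (χ t)‖ - ‖infAction A (z t) (χ t)‖)]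
    have := intervalIntegral.integral_mono_on (μ := MeasureTheory.volume) zero_le_one
      (Continuous.intervalIntegrable (by fun_prop) _ _)
      (Continuous.intervalIntegrable (by fun_prop) _ _) hb
    rw [intervalIntegral.integral_add (Continuous.intervalIntegrable (by fun_prop) _ _)
      (by simp), intervalIntegral.integral_const_mul, intervalIntegral.integral_const] at this
    simp only [sub_zero, one_smul] at this
    nlinarith [mul_nonneg (sq_nonneg (1 / r)) i2, sq_nonneg ‖v‖]
  have hv : v = 0 := by
    by_contra hne
    exact lt_irrefl _ (key (‖v‖ ^ 2) (by positivity)).1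
  have hint : ∫ t in (0 : ℝ)..1, ‖w t‖ ^ 2 = 0 := by
    refine le_antisymm (le_of_forall_pos_le_add fun ε hε => ?_)
      (intervalIntegral.integral_nonneg zero_le_one fun t _ => by positivity)
    have hK : 0 < 2 + 2 * (C * R) ^ 2 * r ^ 2 := by positivity
    refine (key (ε / (2 + 2 * (C * R) ^ 2 * r ^ 2)) (by positivity)).2.trans ?_
    rw [mul_div_cancel₀ _ hK.ne', zero_add]
  have hw0 : ∀ t ∈ Set.Icc (0 : ℝ) 1, w t = 0 := by
    intro t ht
    by_contra hne
    have := intervalIntegral.integral_pos zero_lt_one (f := fun t => ‖w t‖ ^ 2)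
      (by fun_prop) (fun t _ => by positivity) ⟨t, ht, by positivity⟩
    linarith
  refine Prod.ext (funext fun t => ?_) hv
  obtain ⟨y, hy, e⟩ := hw.2.exists_mem_Ico₀ zero_lt_one t
  simp only at e ⊢
  rw [e, hw0 y ⟨hy.1, hy.2.le⟩]
  rfl

theorem isSmoothLoop_momentMap (A : Matrix (Fin n) (Fin k) ℤ) {z : ℝ → CSpace n}
    (hz : IsSmoothLoop z) : IsSmoothLoop fun t => momentMap A (z t) :=
  ⟨(contDiff_momentMap A).comp hz.1, fun t => by simp [hz.2 t]⟩

theorem integral_momentMap_sub_meanMoment (A : Matrix (Fin n) (Fin k) ℤ) {z : ℝ → CSpace n}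
    (hz : IsSmoothLoop z) : ∫ t in (0 : ℝ)..1, (momentMap A (z t) - meanMoment A z) = 0 := by
  rw [intervalIntegral.integral_sub
    ((isSmoothLoop_momentMap A hz).1.continuous.intervalIntegrable _ _) (by simp)]
  simp [meanMoment]

/-- The horizontal representative of the gradient of the action is orthogonal to the gauge
orbit. -/
theorem l2Metric_infGauge_eq_zero (A : Matrix (Fin n) (Fin k) ℤ) {r : ℝ} (hr : r ≠ 0)
    {z : ℝ → CSpace n} (hz : IsSmoothLoop z) (η c : TorusLie k) {χ : ℝ → TorusLie k}
    (hχ : χ ∈ lieGauge k) :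
    l2Metric (fun t => Complex.I • (deriv z t + infAction A (z t) η),
      fun t => r • momentMap A (z t) + c) (infGauge A r z χ) = 0 := by
  have hμ := isSmoothLoop_momentMap A hz
  -- The integrand of the pairing is this exact `t`-derivative: the weight `r` on `μ` cancels the
  -- `1/r` of the gauge action and leaves `⟨μ, deriv χ⟩`, which the moment map identity completes by
  -- the product rule.
  have h1 : ∀ t, HasDerivAt (fun t => -(inner ℝ (momentMap A (z t)) (χ t) +
      (1 / r) * inner ℝ c (χ t)))
      (-((inner ℝ (momentMap A (z t)) (deriv χ t) +
        inner ℝ (momentDeriv A (z t) (deriv z t)) (χ t)) +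
        (1 / r) * inner ℝ c (deriv χ t))) t := by
    intro t
    have a1 := (hasDerivAt_momentMap A (hz.hasDerivAt t)).inner ℝ (hχ.1.hasDerivAt t)
    have a2 := (hasDerivAt_const t c).inner ℝ (hχ.1.hasDerivAt t)
    rw [inner_zero_left, add_zero] at a2
    exact (a1.add (a2.const_mul (1 / r))).neg
  have hc : Continuous fun t => momentDeriv A (z t) (deriv z t) :=
    (continuous_momentDeriv A).comp (hz.1.continuous.prodMk hz.deriv.1.continuous)
  have c1 := hμ.1.continuous
  have c2 := hχ.1.1.continuous
  have c3 := hχ.1.deriv.1.continuous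
  rw [← integral_eq_zero_of_periodic h1 (by fun_prop) (fun t => by simp [hz.2 t, hχ.1.2 t])]
  refine intervalIntegral.integral_congr fun t _ => ?_
  simp only [infGauge]
  rw [re_inner_I_smul, symplecticForm_add_left, symplecticForm_infAction, symplecticForm_swap,
    inner_momentDeriv, inner_neg_right, inner_smul_right, inner_add_left, real_inner_smul_left]
  field_simp
  ring

/-- A vector of `ℒ₀` is determined by its quotient inner products, given a horizontal
representative. -/
theorem eq_of_quotientMetric_eq (A : Matrix (Fin n) (Fin k) ℤ) {r : ℝ} (hr : 0 < r)
    {z : ℝ → CSpace n} (hz : IsSmoothLoop z) {v v₀ : (ℝ → CSpace n) × TorusLie k}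
    (hv : IsSmoothLoop v.1) (hv₀ : IsSmoothLoop v₀.1) {h₀ : (ℝ → CSpace n) × (ℝ → TorusLie k)}
    (hc₀ : Continuous h₀.1 ∧ Continuous h₀.2)
    (hor : ∀ χ ∈ lieGauge k, l2Metric h₀ (infGauge A r z χ) = 0) {ξ : ℝ → TorusLie k}
    (hξ : ξ ∈ lieGauge k) (hincl : incl v₀ = h₀ + infGauge A r z ξ)
    (hgrad : quotientMetric A r z v (v - v₀) = l2Metric h₀ (incl (v - v₀))) : v = v₀ := by
  have hus : IsSmoothLoop (v - v₀).1 := ⟨hv.1.sub hv₀.1, hv.2.sub hv₀.2⟩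
  have huc : Continuous (incl (v - v₀)).1 ∧ Continuous (incl (v - v₀)).2 :=
    ⟨hus.1.continuous, continuous_const⟩
  have hQ₀ : quotientLengthSq A r z (incl v₀) = l2Metric h₀ h₀ := by
    rw [hincl]; exact quotientLengthSq_eq A r hz hc₀ hξ hor
  -- Testing against `v - v₀` makes the second polarization term the length of `v₀`, so no
  -- horizontal representative of `v` is needed. With `u = 2(v - v₀)` this is the length of `v₀ +
  -- u`. Comparing it with `‖h₀ + (u - G)‖² = ‖h₀‖² + 2⟨h₀, u⟩ + ‖u - G‖²` for gauge directions `G`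
  -- shows that `u` is an `L²`-limit of such directions.
  have hQ : quotientLengthSq A r z (incl (v + (v - v₀))) =
      l2Metric h₀ h₀ + 4 * l2Metric h₀ (incl (v - v₀)) := by
    rw [quotientMetric, sub_sub_cancel, hQ₀] at hgrad
    linarith
  obtain ⟨u, hu⟩ : ∃ u, u = (v - v₀) + (v - v₀) := ⟨_, rfl⟩
  have husm : IsSmoothLoop u.1 := by rw [hu]; exact ⟨hus.1.add hus.1, hus.2.add hus.2⟩
  have huc' : Continuous (incl u).1 ∧ Continuous (incl u).2 :=
    ⟨husm.1.continuous, continuous_const⟩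
  have h2u : l2Metric h₀ (incl u) = 2 * l2Metric h₀ (incl (v - v₀)) := by
    rw [l2Metric_comm, hu, show incl ((v - v₀) + (v - v₀)) = incl (v - v₀) + incl (v - v₀) from rfl,
      l2Metric_add_left huc huc hc₀, l2Metric_comm (incl (v - v₀))]
    ring
  have hu0 : u = 0 := by
    refine eq_zero_of_forall_exists_l2Metric_lt A hr hz husm fun ε hε => ?_
    have hlt : quotientLengthSq A r z (incl (v + (v - v₀))) <
        l2Metric h₀ h₀ + 4 * l2Metric h₀ (incl (v - v₀)) + ε := by rw [hQ]; linarith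
    obtain ⟨_, ⟨χ, hχ, rfl⟩, hχlt⟩ := exists_lt_of_csInf_lt
      ⟨_, Set.mem_image_of_mem _ hξ⟩ hlt
    refine ⟨χ + -ξ, lieGauge_add hχ (lieGauge_neg hξ), ?_⟩
    have hm := lieGauge_add hχ (lieGauge_neg hξ)
    have hG := continuous_infGauge A r hz hm
    have hGn : Continuous (-infGauge A r z (χ + -ξ)).1 ∧
        Continuous (-infGauge A r z (χ + -ξ)).2 := ⟨hG.1.neg, hG.2.neg⟩
    have e : incl (v + (v - v₀)) - infGauge A r z χ =
        h₀ + (incl u + -infGauge A r z (χ + -ξ)) := by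
      rw [infGauge_add A r z hχ (lieGauge_neg hξ), infGauge_neg,
        show v + (v - v₀) = v₀ + u by rw [hu]; abel, show incl (v₀ + u) = incl v₀ + incl u from rfl,
        hincl]
      abel
    simp only [e] at hχlt
    rw [l2Metric_add_self hc₀ ⟨huc'.1.add hGn.1, huc'.2.add hGn.2⟩, l2Metric_comm h₀ (_ + _),
      l2Metric_add_left huc' hGn hc₀, l2Metric_neg_left,
      l2Metric_comm (incl u) h₀, l2Metric_comm (infGauge A r z _) h₀, hor _ hm, h2u] at hχlt
    rw [sub_eq_add_neg]
    linarith
  have : (2 : ℝ) • (v - v₀) = 0 := by rw [two_smul, ← hu, hu0]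
  exact sub_eq_zero.1 ((smul_eq_zero.1 this).resolve_left two_ne_zero)

/-- Pairings with vectors tangent to `ℒ₀` only see the mean of the second component. -/
theorem l2Metric_incl_eq (A : Matrix (Fin n) (Fin k) ℤ) (r : ℝ) {z : ℝ → CSpace n}
    (hz : IsSmoothLoop z) (τ : TorusLie k) {a : ℝ → CSpace n} (ha : Continuous a)
    {w : (ℝ → CSpace n) × TorusLie k} (hw : Continuous w.1) :
    l2Metric (a, fun t => momentMap A (z t) - τ) (incl w) =
      l2Metric (a, fun t => r • momentMap A (z t) +
        (meanMoment A z - τ - r • meanMoment A z)) (incl w) := by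
  have hcμ := (isSmoothLoop_momentMap A hz).1.continuous
  have e : ∫ t in (0 : ℝ)..1, inner ℝ (momentMap A (z t) - meanMoment A z) w.2 = 0 := by
    rw [integral_inner_const_right (f := fun t => momentMap A (z t) - meanMoment A z) (by fun_prop),
      integral_momentMap_sub_meanMoment A hz, inner_zero_left]
  rw [← sub_eq_zero]
  unfold l2Metric
  simp only [incl]
  rw [← intervalIntegral.integral_sub (Continuous.intervalIntegrable (by fun_prop) _ _)
    (Continuous.intervalIntegrable (by fun_prop) _ _)]
  refine Eq.trans ?_ ((congrArg ((1 - r) * ·) e).trans (mul_zero _))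
  rw [← intervalIntegral.integral_const_mul]
  refine intervalIntegral.integral_congr fun t _ => ?_
  simp only [inner_sub_left, inner_add_left, real_inner_smul_left]
  ring

theorem isSmoothLoop_infAction (A : Matrix (Fin n) (Fin k) ℤ) {z : ℝ → CSpace n}
    (hz : IsSmoothLoop z) {ξ : ℝ → TorusLie k} (hξ : IsSmoothLoop ξ) :
    IsSmoothLoop fun t => infAction A (z t) (ξ t) := by
  have h : ContDiff ℝ ∞ ((fun p : CSpace n × TorusLie k => infAction A p.1 p.2) ∘
      fun t => (z t, ξ t)) := (contDiff_infAction A).comp (hz.1.prodMk hξ.1)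
  refine ⟨h, fun t => ?_⟩
  change infAction A (z (t + 1)) (ξ (t + 1)) = _
  rw [hz.2 t, hξ.2 t]

theorem isSmoothLoop_I_smul {z : ℝ → CSpace n} (hz : IsSmoothLoop z) :
    IsSmoothLoop fun t => Complex.I • z t :=
  ⟨hz.1.const_smul Complex.I, fun t => by simp only [hz.2 t]⟩

/-- The gradient of `𝒜₀` with respect to `g_r`. -/
theorem IsGradient.eq {A : Matrix (Fin n) (Fin k) ℤ} {τ : TorusLie k} {r : ℝ} (hr : 0 < r)
    {z : ℝ → CSpace n} (hz : IsSmoothLoop z) {η : TorusLie k}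
    {v : (ℝ → CSpace n) × TorusLie k} (h : IsGradient A τ r (z, η) v) :
    ∃ ξ : ℝ → TorusLie k,
      (∀ t, HasDerivAt ξ (r ^ 2 • (momentMap A (z t) - meanMoment A z)) t) ∧
      (∀ t, v.1 t = Complex.I • (deriv z t + infAction A (z t) η) + infAction A (z t) (ξ t)) ∧
      v.2 = meanMoment A z - τ := by
  have hμ := isSmoothLoop_momentMap A hz
  obtain ⟨ξ, hξ, hξ'⟩ := exists_mem_lieGauge_hasDerivAt
    (φ := fun t => r ^ 2 • (momentMap A (z t) - meanMoment A z))
    ⟨(hμ.1.sub contDiff_const).const_smul _, fun t => by simp [hz.2 t]⟩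
    (by rw [intervalIntegral.integral_smul, integral_momentMap_sub_meanMoment A hz, smul_zero])
  have hLη : IsSmoothLoop fun t => infAction A (z t) η :=
    isSmoothLoop_infAction A hz ⟨contDiff_const, fun _ => rfl⟩
  have hsm : IsSmoothLoop fun t => Complex.I • (deriv z t + infAction A (z t) η) :=
    isSmoothLoop_I_smul ⟨hz.deriv.1.add hLη.1, hz.deriv.2.add hLη.2⟩
  have hL : IsSmoothLoop fun t => infAction A (z t) (ξ t) :=
    isSmoothLoop_infAction A hz hξ.1
  -- Horizontality asks for second component `rμ + c`. Adding the gauge direction of `ξ` contributes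
  -- `-r(μ - m)`, and this `c` makes the sum the constant `m - τ`, a vector tangent to `ℒ₀`.
  set c := meanMoment A z - τ - r • meanMoment A z with hc
  obtain ⟨h₀, hh₀⟩ : ∃ h₀ : (ℝ → CSpace n) × (ℝ → TorusLie k), h₀ =
    (fun t => Complex.I • (deriv z t + infAction A (z t) η),
      fun t => r • momentMap A (z t) + c) := ⟨_, rfl⟩
  have hc₀ : Continuous h₀.1 ∧ Continuous h₀.2 := by
    rw [hh₀]; exact ⟨hsm.1.continuous, (hμ.1.continuous.const_smul r).add continuous_const⟩
  have hor : ∀ χ ∈ lieGauge k, l2Metric h₀ (infGauge A r z χ) = 0 := fun χ hχ => by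
    rw [hh₀]; exact l2Metric_infGauge_eq_zero A hr.ne' hz η c hχ
  obtain ⟨v₀, hv₀⟩ : ∃ v₀ : (ℝ → CSpace n) × TorusLie k, v₀ =
    (fun t => Complex.I • (deriv z t + infAction A (z t) η) + infAction A (z t) (ξ t),
      meanMoment A z - τ) := ⟨_, rfl⟩
  have hincl : incl v₀ = h₀ + infGauge A r z ξ := by
    rw [hv₀, hh₀]
    refine Prod.ext rfl (funext fun t => ?_)
    simp only [incl, infGauge, Prod.snd_add, Pi.add_apply, (hξ' t).deriv, hc, smul_smul]
    rw [show 1 / r * r ^ 2 = r by field_simp, smul_sub]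
    abel
  have hv₀s : IsSmoothLoop v₀.1 := by
    rw [hv₀]; exact ⟨hsm.1.add hL.1, hsm.2.add hL.2⟩
  have hus : IsSmoothLoop (v - v₀).1 := ⟨h.1.1.sub hv₀s.1, h.1.2.sub hv₀s.2⟩
  have huc : Continuous (incl (v - v₀)).1 ∧ Continuous (incl (v - v₀)).2 :=
    ⟨hus.1.continuous, continuous_const⟩
  have hgrad : quotientMetric A r z v (v - v₀) = l2Metric h₀ (incl (v - v₀)) := by
    refine ((h.2 _ hus).unique (hasDerivAt_action₀ A τ hz η hus)).trans ?_
    rw [hh₀]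
    exact l2Metric_incl_eq A r hz τ hsm.1.continuous hus.1.continuous
  have hv : v = v₀ := eq_of_quotientMetric_eq A hr hz h.1 hv₀s hc₀ hor hξ hincl hgrad
  exact ⟨ξ, hξ', fun t => by rw [hv, hv₀], by rw [hv, hv₀]⟩

/-! ### The Laplacian of the squared norm along a flow line -/

/-- The Laplacian of `|f|²` for a solution `f = a + ib` of the perturbed Cauchy–Riemann equation
`∂ₛf + i∂ₜf = (α - iβ)f`. -/
theorem laplacian_sq_add_sq {a b β β' : ℝ → ℝ → ℝ} {α α' : ℝ → ℝ}
    (ha : ContDiff ℝ ∞ fun p : ℝ × ℝ => a p.1 p.2) (hb : ContDiff ℝ ∞ fun p : ℝ × ℝ => b p.1 p.2)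
    (hα : ∀ s, HasDerivAt α (α' s) s) (hβ : ∀ s t, HasDerivAt (β s) (β' s t) t)
    (has : ∀ s t, deriv (fun σ => a σ t) s = deriv (b s) t + α s * a s t + β s t * b s t)
    (hbs : ∀ s t, deriv (fun σ => b σ t) s = -deriv (a s) t + α s * b s t - β s t * a s t)
    (s t : ℝ) :
    deriv (deriv fun σ => a σ t ^ 2 + b σ t ^ 2) s + deriv (deriv fun y => a s y ^ 2 + b s y ^ 2) t =
      4 * ((deriv (a s) t - α s * b s t) ^ 2 + (deriv (b s) t + α s * a s t) ^ 2) +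
        2 * (α' s - β' s t) * (a s t ^ 2 + b s t ^ 2) := by
  have hat : ∀ s t, HasDerivAt (a s) (deriv (a s) t) t := fun s t =>
    (hasDerivAt_snd_of_contDiff ha s t).differentiableAt.hasDerivAt
  have hbt : ∀ s t, HasDerivAt (b s) (deriv (b s) t) t := fun s t =>
    (hasDerivAt_snd_of_contDiff hb s t).differentiableAt.hasDerivAt
  have has' : ∀ s t, HasDerivAt (fun σ => a σ t)
      (deriv (b s) t + α s * a s t + β s t * b s t) s := fun s t =>
    (hasDerivAt_fst_of_contDiff ha s t).differentiableAt.hasDerivAt.congr_deriv (has s t)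
  have hbs' : ∀ s t, HasDerivAt (fun σ => b σ t)
      (-deriv (a s) t + α s * b s t - β s t * a s t) s := fun s t =>
    (hasDerivAt_fst_of_contDiff hb s t).differentiableAt.hasDerivAt.congr_deriv (hbs s t)
  have hatt : ∀ s t, HasDerivAt (deriv (a s)) (deriv (deriv (a s)) t) t := fun s t =>
    (hasDerivAt_snd_of_contDiff (f := fun s t => deriv (a s) t)
      (contDiff_deriv_snd ha) s t).differentiableAt.hasDerivAt
  have hbtt : ∀ s t, HasDerivAt (deriv (b s)) (deriv (deriv (b s)) t) t := fun s t =>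
    (hasDerivAt_snd_of_contDiff (f := fun s t => deriv (b s) t)
      (contDiff_deriv_snd hb) s t).differentiableAt.hasDerivAt
  have hats : HasDerivAt (fun σ => deriv (a σ) t) (deriv (deriv (b s)) t + α s * deriv (a s) t +
      (β' s t * b s t + β s t * deriv (b s) t)) s := by
    have h := (hasDerivAt_fst_of_contDiff (f := fun s t => deriv (a s) t)
      (contDiff_deriv_snd ha) s t).differentiableAt.hasDerivAt
    rw [deriv_deriv_comm ha, funext (has s)] at h
    refine h.congr_deriv (HasDerivAt.deriv ?_)
    exact ((hbtt s t).add ((hat s t).const_mul (α s))).add ((hβ s t).mul (hbt s t))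
  have hbts : HasDerivAt (fun σ => deriv (b σ) t) (-deriv (deriv (a s)) t + α s * deriv (b s) t -
      (β' s t * a s t + β s t * deriv (a s) t)) s := by
    have h := (hasDerivAt_fst_of_contDiff (f := fun s t => deriv (b s) t)
      (contDiff_deriv_snd hb) s t).differentiableAt.hasDerivAt
    rw [deriv_deriv_comm hb, funext (hbs s)] at h
    refine h.congr_deriv (HasDerivAt.deriv ?_)
    exact ((hatt s t).neg.add ((hbt s t).const_mul (α s))).sub ((hβ s t).mul (hat s t))
  -- The `β` term is an infinitesimal rotation and drops out of `∂ₛ|f|²`. Hence only the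
  -- `t`-derivative of `β` is ever needed.
  have hs1 : (deriv fun σ => a σ t ^ 2 + b σ t ^ 2) = fun σ =>
      2 * (a σ t * deriv (b σ) t - b σ t * deriv (a σ) t) +
        2 * α σ * (a σ t * a σ t + b σ t * b σ t) := by
    funext σ
    refine (((has' σ t).pow 2).add ((hbs' σ t).pow 2)).deriv.trans ?_
    push_cast
    ring
  have ht1 : (deriv fun y => a s y ^ 2 + b s y ^ 2) = fun y =>
      2 * (a s y * deriv (a s) y + b s y * deriv (b s) y) := by
    funext y
    refine (((hat s y).pow 2).add ((hbt s y).pow 2)).deriv.trans ?_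
    push_cast
    ring
  have hs2 := (((((has' s t).mul hbts).sub ((hbs' s t).mul hats)).const_mul 2).add
    (((hα s).const_mul 2).mul (((has' s t).mul (has' s t)).add ((hbs' s t).mul (hbs' s t))))).deriv
  have ht2 := ((((hat s t).mul (hatt s t)).add ((hbt s t).mul (hbtt s t))).const_mul 2).deriv
  rw [hs1, ht1]
  refine (congrArg₂ (· + ·) hs2 ht2).trans ?_
  simp only [Pi.add_apply, Pi.mul_apply]
  ring

theorem deriv_deriv_sum {ι : Type*} [Fintype ι] {f : ι → ℝ → ℝ} (hf : ∀ j, ContDiff ℝ ∞ (f j))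
    (x : ℝ) : deriv (deriv fun y => ∑ j, f j y) x = ∑ j, deriv (deriv (f j)) x := by
  have h : (deriv fun y => ∑ j, f j y) = fun y => ∑ j, deriv (f j) y := funext fun y =>
    (HasDerivAt.fun_sum fun j _ => ((hf j).differentiable (by simp) y).hasDerivAt).deriv
  rw [h]
  exact (HasDerivAt.fun_sum fun j _ =>
    ((contDiff_infty_iff_deriv.1 (hf j)).2.differentiable (by simp) x).hasDerivAt).deriv

theorem inner_momentMap (A : Matrix (Fin n) (Fin k) ℤ) (z : CSpace n) (ξ : TorusLie k) :
    inner ℝ (momentMap A z) ξ = -(1 / 2) * ∑ j, weight A ξ j * ‖z j‖ ^ 2 := by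
  simp only [momentMap, weight, PiLp.inner_apply, RCLike.inner_apply, conj_trivial,
    Finset.mul_sum, Finset.sum_mul]
  rw [Finset.sum_comm]
  exact Finset.sum_congr rfl fun j _ => Finset.sum_congr rfl fun l _ => by ring

theorem hasDerivAt_weight (A : Matrix (Fin n) (Fin k) ℤ) {ξ : ℝ → TorusLie k} {ξ' : TorusLie k}
    {t : ℝ} (hξ : HasDerivAt ξ ξ' t) (j : Fin n) :
    HasDerivAt (fun t => weight A (ξ t) j) (weight A ξ' j) t :=
  HasDerivAt.fun_sum fun l _ =>
    ((PiLp.proj 2 (𝕜 := ℝ) (fun _ : Fin k => ℝ) l).hasFDerivAt.comp_hasDerivAt t hξ).const_mul _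

theorem norm_sq_eq_sum_re_im (z : CSpace n) : ‖z‖ ^ 2 = ∑ j, ((z j).re ^ 2 + (z j).im ^ 2) := by
  rw [EuclideanSpace.norm_sq_eq]
  refine Finset.sum_congr rfl fun j _ => ?_
  rw [Complex.sq_norm, Complex.normSq_apply]
  ring

theorem IsFlowLine.isSmoothLoop {A : Matrix (Fin n) (Fin k) ℤ} {τ : TorusLie k} {r : ℝ}
    {z : ℝ → ℝ → CSpace n} {η : ℝ → TorusLie k} (h : IsFlowLine A τ r z η) (s : ℝ) :
    IsSmoothLoop (z s) :=
  ⟨h.smooth_fst.comp (by fun_prop : ContDiff ℝ ∞ fun t : ℝ => (s, t)), h.periodic s⟩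

/-- The gradient flow equation, written out. -/
theorem IsFlowLine.exists_eq {A : Matrix (Fin n) (Fin k) ℤ} {τ : TorusLie k} {r : ℝ} (hr : 0 < r)
    {z : ℝ → ℝ → CSpace n} {η : ℝ → TorusLie k} (h : IsFlowLine A τ r z η) :
    ∃ ξ : ℝ → ℝ → TorusLie k,
      (∀ s t, HasDerivAt (ξ s) (r ^ 2 • (momentMap A (z s t) - meanMoment A (z s))) t) ∧
      (∀ s t, deriv (fun σ => z σ t) s =
        -(Complex.I • (deriv (z s) t + infAction A (z s t) (η s)) +
          infAction A (z s t) (ξ s t))) ∧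
      ∀ s, deriv η s = -(meanMoment A (z s) - τ) := by
  -- The choice is made separately for each `s`, so `ξ` comes with no regularity in `s`;
  -- `laplacian_sq_add_sq` asks for none.
  choose ξ h1 h2 h3 using fun s => (h.flow s).eq hr (h.isSmoothLoop s)
  refine ⟨ξ, h1, fun s t => ?_, fun s => ?_⟩
  · rw [← h2 s t]
    simp
  · rw [← h3 s]
    simp

/-- The Laplacian of `‖z‖²` along a flow line. -/
theorem IsFlowLine.laplacian_norm_sq {A : Matrix (Fin n) (Fin k) ℤ} {τ : TorusLie k} {r : ℝ}
    (hr : 0 < r) {z : ℝ → ℝ → CSpace n} {η : ℝ → TorusLie k} (h : IsFlowLine A τ r z η)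
    (s t : ℝ) :
    deriv (deriv fun σ => ‖z σ t‖ ^ 2) s + deriv (deriv fun y => ‖z s y‖ ^ 2) t =
      4 * ‖deriv (z s) t + infAction A (z s t) (η s)‖ ^ 2 +
        4 * inner ℝ (momentMap A (z s t)) (meanMoment A (z s) - τ +
          r ^ 2 • (momentMap A (z s t) - meanMoment A (z s))) := by
  obtain ⟨ξ, h1, h2, h3⟩ := h.exists_eq hr
  have hzj : ∀ j, ContDiff ℝ ∞ fun p : ℝ × ℝ => z p.1 p.2 j := fun j =>
    (PiLp.proj 2 (𝕜 := ℝ) (fun _ : Fin n => ℂ) j).contDiff.comp h.smooth_fst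
  have hre : ∀ j, ContDiff ℝ ∞ fun p : ℝ × ℝ => (z p.1 p.2 j).re := fun j =>
    Complex.reCLM.contDiff.comp (hzj j)
  have him : ∀ j, ContDiff ℝ ∞ fun p : ℝ × ℝ => (z p.1 p.2 j).im := fun j =>
    Complex.imCLM.contDiff.comp (hzj j)
  have dt : ∀ s t j, HasDerivAt (fun t => z s t j) (deriv (z s) t j) t := fun s t j =>
    hasDerivAt_coord ((h.isSmoothLoop s).hasDerivAt t) j
  have ds : ∀ s t j, HasDerivAt (fun σ => z σ t j) (deriv (fun σ => z σ t) s j) s := fun s t j =>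
    hasDerivAt_coord
      (hasDerivAt_fst_of_contDiff h.smooth_fst s t).differentiableAt.hasDerivAt j
  have dret : ∀ s t j, deriv (fun t => (z s t j).re) t = (deriv (z s) t j).re := fun s t j =>
    (hasDerivAt_complex_re (dt s t j)).deriv
  have dimt : ∀ s t j, deriv (fun t => (z s t j).im) t = (deriv (z s) t j).im := fun s t j =>
    (hasDerivAt_complex_im (dt s t j)).deriv
  have key := fun j => laplacian_sq_add_sq (a := fun s t => (z s t j).re)
    (b := fun s t => (z s t j).im) (α := fun s => weight A (η s) j)
    (β := fun s t => weight A (ξ s t) j) (hre j) (him j)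
    (fun s => hasDerivAt_weight A (h.smooth_snd.differentiable (by simp) s).hasDerivAt j)
    (fun s t => hasDerivAt_weight A (h1 s t) j)
    (fun s t => by
      rw [(hasDerivAt_complex_re (ds s t j)).deriv, h2 s t, dimt]
      simp [infAction]
      ring)
    (fun s t => by
      rw [(hasDerivAt_complex_im (ds s t j)).deriv, h2 s t, dret]
      simp [infAction]
      ring) s t
  have hsm : ∀ j, ContDiff ℝ ∞ fun p : ℝ × ℝ => (z p.1 p.2 j).re ^ 2 + (z p.1 p.2 j).im ^ 2 :=
    fun j => ((hre j).pow 2).add ((him j).pow 2)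
  simp only [norm_sq_eq_sum_re_im (z _ _)]
  rw [deriv_deriv_sum (f := fun j σ => (z σ t j).re ^ 2 + (z σ t j).im ^ 2) (fun j =>
      (hsm j).comp (by fun_prop : ContDiff ℝ ∞ fun σ : ℝ => (σ, t))),
    deriv_deriv_sum (f := fun j y => (z s y j).re ^ 2 + (z s y j).im ^ 2) (fun j =>
      (hsm j).comp (by fun_prop : ContDiff ℝ ∞ fun y : ℝ => (s, y))),
    ← Finset.sum_add_distrib, Finset.sum_congr rfl fun j _ => key j, norm_sq_eq_sum_re_im,
    inner_momentMap, Finset.mul_sum, Finset.mul_sum, Finset.mul_sum, ← Finset.sum_add_distrib]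
  refine Finset.sum_congr rfl fun j _ => ?_
  -- This sign, with the `-1/2` in `inner_momentMap`, turns the sum of `2(α' - β')|z j|²` into `4⟨μ,
  -- m - τ + r²(μ - m)⟩`.
  have hw : weight A (deriv η s) j = -weight A (meanMoment A (z s) - τ) j := by
    rw [h3 s, ← neg_one_smul ℝ, weight_smul]
    ring
  rw [dret, dimt, hw, weight_add, Complex.sq_norm (z s t j), Complex.normSq_apply]
  simp only [infAction, PiLp.add_apply, Complex.add_re, Complex.add_im, Complex.mul_re,
    Complex.mul_im, Complex.I_re, Complex.I_im, Complex.ofReal_re, Complex.ofReal_im]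
  ring

/-! ### Bounds on the moment map and the mean norm -/

/-- Pair `μ` with itself: `‖μ‖²` is a combination of the `‖z j‖²` whose coefficients are bounded by
a multiple of `‖μ‖`; then divide by `‖μ‖`. -/
theorem exists_norm_momentMap_le (A : Matrix (Fin n) (Fin k) ℤ) :
    ∃ C, 0 ≤ C ∧ ∀ z, ‖momentMap A z‖ ≤ C * ‖z‖ ^ 2 := by
  obtain ⟨C, hC0, hC⟩ := exists_abs_weight_le A
  refine ⟨C, hC0, fun z => ?_⟩
  rcases (norm_nonneg (momentMap A z)).eq_or_lt with h0 | hpos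
  · rw [← h0]; positivity
  have h : ‖momentMap A z‖ ^ 2 ≤ C * ‖momentMap A z‖ * ‖z‖ ^ 2 := by
    rw [← real_inner_self_eq_norm_sq, inner_momentMap, EuclideanSpace.norm_sq_eq z,
      Finset.mul_sum, Finset.mul_sum]
    refine Finset.sum_le_sum fun j _ => ?_
    have h1 := (abs_le.1 (hC (momentMap A z) j)).1
    have h2 : 0 ≤ C * ‖momentMap A z‖ := by positivity
    nlinarith [sq_nonneg ‖z j‖]
  nlinarith

theorem momentMap_smul (A : Matrix (Fin n) (Fin k) ℤ) (c : ℝ) (z : CSpace n) :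
    momentMap A (c • z) = c ^ 2 • momentMap A z := by
  ext l
  simp only [momentMap, PiLp.smul_apply, norm_smul, Real.norm_eq_abs, mul_pow, sq_abs, smul_eq_mul,
    Finset.mul_sum]
  exact Finset.sum_congr rfl fun j _ => by ring

/-- A proper moment map grows at least quadratically. -/
theorem exists_norm_sq_le_norm_momentMap {A : Matrix (Fin n) (Fin k) ℤ}
    (hA : IsProperMap (momentMap A)) : ∃ c, 0 < c ∧ ∀ z, ‖z‖ ^ 2 ≤ c * ‖momentMap A z‖ := by
  obtain ⟨R, hR⟩ := (hA.isCompact_preimage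
    (isCompact_closedBall (0 : TorusLie k) 1)).isBounded.exists_norm_le
  -- A violation of the bound with `c = S²`, rescaled to norm `S > R`, would land in the preimage of
  -- the unit ball, where norms are at most `R`.
  set S := max R 0 + 1 with hS
  have hS0 : 0 < S := by positivity
  refine ⟨S ^ 2, by positivity, fun z => ?_⟩
  rcases eq_or_ne z 0 with rfl | hz
  · rw [norm_zero, zero_pow two_ne_zero]; positivity
  have hz0 : 0 < ‖z‖ := norm_pos_iff.2 hz
  by_contra! hlt
  have hmem : (S / ‖z‖) • z ∈ momentMap A ⁻¹' Metric.closedBall 0 1 := by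
    rw [Set.mem_preimage, mem_closedBall_zero_iff, momentMap_smul, norm_smul, norm_pow, norm_div,
      norm_norm, Real.norm_of_nonneg hS0.le, div_pow, div_mul_eq_mul_div, div_le_one (by positivity)]
    exact hlt.le
  have := hR _ hmem
  rw [norm_smul, norm_div, norm_norm, Real.norm_of_nonneg hS0.le, div_mul_cancel₀ _ hz0.ne'] at this
  linarith [le_max_left R 0]

/-- The mean of the moment map is the moment map at the point of quadratic means. -/
theorem meanMoment_eq (A : Matrix (Fin n) (Fin k) ℤ) {z : ℝ → CSpace n} (hz : IsSmoothLoop z) :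
    meanMoment A z =
      momentMap A (WithLp.toLp 2 fun j => ((√(∫ t in (0 : ℝ)..1, ‖z t j‖ ^ 2) : ℝ) : ℂ)) := by
  have hc := hz.1.continuous
  ext l
  have h1 := (PiLp.proj 2 (𝕜 := ℝ) (fun _ : Fin k => ℝ) l).intervalIntegral_comp_comm
    ((isSmoothLoop_momentMap A hz).1.continuous.intervalIntegrable (μ := MeasureTheory.volume) 0 1)
  rw [meanMoment]
  refine h1.symm.trans ?_
  simp only [PiLp.proj_apply, momentMap]
  rw [intervalIntegral.integral_const_mul, intervalIntegral.integral_finsetSum fun j _ =>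
    Continuous.intervalIntegrable (by fun_prop) _ _]
  congr 1
  refine Finset.sum_congr rfl fun j _ => ?_
  rw [intervalIntegral.integral_const_mul, Complex.norm_real, Real.norm_eq_abs, sq_abs, Real.sq_sqrt
    (intervalIntegral.integral_nonneg zero_le_one fun t _ => by positivity)]

/-- The point of quadratic means has squared norm `∫‖z‖²` and moment `meanMoment A z`, so the
pointwise growth bound applied there survives averaging, although the norm of a mean is in general
smaller than the mean of the norms. -/
theorem integral_norm_sq_le {A : Matrix (Fin n) (Fin k) ℤ} {c : ℝ}
    (hc : ∀ z, ‖z‖ ^ 2 ≤ c * ‖momentMap A z‖) {z : ℝ → CSpace n} (hz : IsSmoothLoop z) :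
    ∫ t in (0 : ℝ)..1, ‖z t‖ ^ 2 ≤ c * ‖meanMoment A z‖ := by
  have hzc := hz.1.continuous
  rw [meanMoment_eq A hz]
  refine Eq.trans_le ?_ (hc _)
  simp only [EuclideanSpace.norm_sq_eq]
  rw [intervalIntegral.integral_finsetSum fun j _ =>
    Continuous.intervalIntegrable (by fun_prop) _ _]
  refine Finset.sum_congr rfl fun j _ => ?_
  rw [Complex.norm_real, Real.norm_eq_abs, sq_abs, Real.sq_sqrt
    (intervalIntegral.integral_nonneg zero_le_one fun t _ => by positivity)]

theorem norm_meanMoment_le {A : Matrix (Fin n) (Fin k) ℤ} {C : ℝ}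
    (hC : ∀ z, ‖momentMap A z‖ ≤ C * ‖z‖ ^ 2) {z : ℝ → CSpace n} (hz : IsSmoothLoop z) :
    ‖meanMoment A z‖ ≤ C * ∫ t in (0 : ℝ)..1, ‖z t‖ ^ 2 := by
  have hzc := hz.1.continuous
  rw [← intervalIntegral.integral_const_mul]
  exact intervalIntegral.norm_integral_le_of_norm_le zero_le_one
    (Filter.Eventually.of_forall fun t _ => hC (z t))
    (Continuous.intervalIntegrable (by fun_prop) _ _)

/-- Along a curve of finite energy the mean moment comes close to `τ` on every set of infinite
measure. -/
theorem exists_norm_meanMoment_sub_le {A : Matrix (Fin n) (Fin k) ℤ} {τ : TorusLie k}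
    {z : ℝ → ℝ → CSpace n} {η : ℝ → TorusLie k} (hE : energy A τ z η < ⊤) {S : Set ℝ}
    (hS : MeasurableSet S) (hvol : MeasureTheory.volume S = ⊤) :
    ∃ s ∈ S, ‖meanMoment A (z s) - τ‖ ≤ 1 := by
  by_contra! h
  refine hE.not_ge ?_
  calc (⊤ : ENNReal) = ∫⁻ _ in S, 1 := by simp [hvol]
    _ ≤ ∫⁻ s in S, ∫⁻ t in Set.Icc (0 : ℝ) 1, ENNReal.ofReal
        (‖deriv (z s) t + infAction A (z s t) (η s)‖ ^ 2 + ‖meanMoment A (z s) - τ‖ ^ 2) := by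
        refine MeasureTheory.setLIntegral_mono' hS fun s hs => ?_
        calc (1 : ENNReal) = ∫⁻ _ in Set.Icc (0 : ℝ) 1, 1 := by simp
          _ ≤ _ := by
            refine MeasureTheory.lintegral_mono fun t => ENNReal.one_le_ofReal.2 ?_
            nlinarith [h s hs, sq_nonneg ‖deriv (z s) t + infAction A (z s t) (η s)‖]
    _ ≤ energy A τ z η := MeasureTheory.setLIntegral_le_lintegral _ _

/-- The `r²` term integrates to `r²` times the variance of `μ` along the loop, which is nonnegative;
what remains does not depend on `r`. -/
theorem integral_inner_momentMap_ge (A : Matrix (Fin n) (Fin k) ℤ) (τ : TorusLie k) (r : ℝ)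
    {z : ℝ → CSpace n} (hz : IsSmoothLoop z) :
    ‖meanMoment A z‖ ^ 2 - inner ℝ (meanMoment A z) τ ≤
      ∫ t in (0 : ℝ)..1, inner ℝ (momentMap A (z t)) (meanMoment A z - τ +
        r ^ 2 • (momentMap A (z t) - meanMoment A z)) := by
  have hμ := (isSmoothLoop_momentMap A hz).1.continuous
  set m := meanMoment A z with hm
  have e : ∀ t, inner ℝ (momentMap A (z t)) (m - τ + r ^ 2 • (momentMap A (z t) - m)) =
      inner ℝ (momentMap A (z t)) (m - τ) + (r ^ 2 * ‖momentMap A (z t) - m‖ ^ 2 +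
        r ^ 2 * inner ℝ (momentMap A (z t) - m) m) := by
    intro t
    rw [inner_add_right, inner_smul_right, ← real_inner_self_eq_norm_sq]
    simp only [inner_sub_left, inner_sub_right]
    rw [real_inner_comm (momentMap A (z t)) m]
    ring
  have h1 : ∫ t in (0 : ℝ)..1, inner ℝ (momentMap A (z t) - m) m = 0 := by
    rw [integral_inner_const_right (f := fun t => momentMap A (z t) - m) (by fun_prop),
      integral_momentMap_sub_meanMoment A hz, inner_zero_left]
  have h2 : 0 ≤ ∫ t in (0 : ℝ)..1, ‖momentMap A (z t) - m‖ ^ 2 :=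
    intervalIntegral.integral_nonneg zero_le_one fun t _ => by positivity
  simp only [e]
  rw [intervalIntegral.integral_add (Continuous.intervalIntegrable (by fun_prop) _ _)
      (Continuous.intervalIntegrable (by fun_prop) _ _),
    intervalIntegral.integral_add (Continuous.intervalIntegrable (by fun_prop) _ _)
      (Continuous.intervalIntegrable (by fun_prop) _ _),
    intervalIntegral.integral_const_mul, intervalIntegral.integral_const_mul, h1,
    integral_inner_const_right hμ, ← meanMoment, ← hm, inner_sub_right, real_inner_self_eq_norm_sq]
  nlinarith [mul_nonneg (sq_nonneg r) h2]

/-! ### Mean bounds and pointwise inequalities along flow lines -/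

theorem IsFlowLine.contDiff_norm_sq {A : Matrix (Fin n) (Fin k) ℤ} {τ : TorusLie k} {r : ℝ}
    {z : ℝ → ℝ → CSpace n} {η : ℝ → TorusLie k} (h : IsFlowLine A τ r z η) :
    ContDiff ℝ ∞ fun p : ℝ × ℝ => ‖z p.1 p.2‖ ^ 2 :=
  h.smooth_fst.norm_sq ℝ

theorem IsFlowLine.continuous_covariantDeriv {A : Matrix (Fin n) (Fin k) ℤ} {τ : TorusLie k}
    {r : ℝ} {z : ℝ → ℝ → CSpace n} {η : ℝ → TorusLie k} (h : IsFlowLine A τ r z η) (s : ℝ) :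
    Continuous fun t => deriv (z s) t + infAction A (z s t) (η s) :=
  (h.isSmoothLoop s).deriv.1.continuous.add
    (isSmoothLoop_infAction A (h.isSmoothLoop s) (ξ := fun _ => η s)
      ⟨contDiff_const, fun _ => rfl⟩).1.continuous

theorem isSmoothLoop_norm_sq {z : ℝ → CSpace n} (hz : IsSmoothLoop z) :
    IsSmoothLoop fun t => ‖z t‖ ^ 2 := by
  refine ⟨hz.1.norm_sq ℝ, fun t => ?_⟩
  change ‖z (t + 1)‖ ^ 2 = _
  rw [hz.2 t]

/-- The second derivative of the mean of `‖z‖²` along a flow line. -/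
theorem IsFlowLine.deriv_deriv_integral_ge {A : Matrix (Fin n) (Fin k) ℤ} {τ : TorusLie k} {r : ℝ}
    (hr : 0 < r) {z : ℝ → ℝ → CSpace n} {η : ℝ → TorusLie k} (h : IsFlowLine A τ r z η) (s : ℝ) :
    4 * (∫ t in (0 : ℝ)..1, ‖deriv (z s) t + infAction A (z s t) (η s)‖ ^ 2) +
        4 * (‖meanMoment A (z s)‖ ^ 2 - inner ℝ (meanMoment A (z s)) τ) ≤
      deriv (deriv fun σ => ∫ t in (0 : ℝ)..1, ‖z σ t‖ ^ 2) s := by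
  have hu := h.contDiff_norm_sq
  have hz := h.isSmoothLoop s
  have hD := h.continuous_covariantDeriv s
  have hμ := (isSmoothLoop_momentMap A hz).1.continuous
  have hsc : Continuous fun t => deriv (deriv fun σ => ‖z σ t‖ ^ 2) s :=
    continuous_deriv_deriv_fst (f := fun σ t => ‖z σ t‖ ^ 2) hu s
  have hloop : IsSmoothLoop fun t => ‖z s t‖ ^ 2 := isSmoothLoop_norm_sq hz
  have htc : Continuous (deriv (deriv fun y => ‖z s y‖ ^ 2)) := hloop.deriv.deriv.1.continuous
  have ht0 : ∫ t in (0 : ℝ)..1, deriv (deriv fun y => ‖z s y‖ ^ 2) t = 0 :=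
    integral_eq_zero_of_periodic hloop.deriv.hasDerivAt htc hloop.deriv.2
  have e : deriv (deriv fun σ => ∫ t in (0 : ℝ)..1, ‖z σ t‖ ^ 2) s =
      ∫ t in (0 : ℝ)..1, (4 * ‖deriv (z s) t + infAction A (z s t) (η s)‖ ^ 2 +
        4 * inner ℝ (momentMap A (z s t)) (meanMoment A (z s) - τ +
          r ^ 2 • (momentMap A (z s t) - meanMoment A (z s)))) := by
    simp only [← h.laplacian_norm_sq hr]
    rw [intervalIntegral.integral_add (hsc.intervalIntegrable _ _) (htc.intervalIntegrable _ _),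
      ht0, add_zero]
    exact (hasDerivAt_deriv_integral_of_contDiff (f := fun σ t => ‖z σ t‖ ^ 2) hu s).deriv
  rw [e, intervalIntegral.integral_add (Continuous.intervalIntegrable (by fun_prop) _ _)
      (Continuous.intervalIntegrable (by fun_prop) _ _),
    intervalIntegral.integral_const_mul, intervalIntegral.integral_const_mul]
  linarith [integral_inner_momentMap_ge A τ r hz]

/-- The means of `‖z‖²` over circles are uniformly bounded along flow lines of finite energy. -/
theorem IsFlowLine.integral_norm_sq_le {A : Matrix (Fin n) (Fin k) ℤ} {τ : TorusLie k} {r c : ℝ}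
    (hr : 0 < r) (hc0 : 0 < c) (hc : ∀ z, ‖z‖ ^ 2 ≤ c * ‖momentMap A z‖)
    {z : ℝ → ℝ → CSpace n} {η : ℝ → TorusLie k} (h : IsFlowLine A τ r z η)
    (hE : energy A τ z η < ⊤) (s : ℝ) :
    ∫ t in (0 : ℝ)..1, ‖z s t‖ ^ 2 ≤ c * (‖τ‖ + 1) := by
  have hle := fun s => MomentFloer.integral_norm_sq_le hc (h.isSmoothLoop s)
  have hclose : ∀ s, ‖meanMoment A (z s) - τ‖ ≤ 1 →
      ∫ t in (0 : ℝ)..1, ‖z s t‖ ^ 2 ≤ c * (‖τ‖ + 1) := by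
    intro s hs
    refine (hle s).trans ?_
    gcongr
    have := norm_add_le τ (meanMoment A (z s) - τ)
    rw [add_sub_cancel] at this
    linarith
  refine le_of_deriv_deriv_pos (m := fun s => ∫ t in (0 : ℝ)..1, ‖z s t‖ ^ 2)
    (continuous_iff_continuousAt.2 fun s => (hasDerivAt_integral_of_contDiff
      (f := fun σ t => ‖z σ t‖ ^ 2) h.contDiff_norm_sq s).continuousAt)
    (fun s hs => ?_) (fun s => ?_) (fun s => ?_) s
  -- Above the threshold `‖m‖` exceeds `‖τ‖`, so `‖m‖² - ⟨m, τ⟩ > 0` and the mean is strictly convex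
  -- there.
  · have h1 : ‖τ‖ + 1 < ‖meanMoment A (z s)‖ :=
      lt_of_mul_lt_mul_left (hs.trans_le (hle s)) hc0.le
    have h2 := real_inner_le_norm (meanMoment A (z s)) τ
    have h3 : 0 ≤ ∫ t in (0 : ℝ)..1, ‖deriv (z s) t + infAction A (z s t) (η s)‖ ^ 2 :=
      intervalIntegral.integral_nonneg zero_le_one fun t _ => by positivity
    have h4 := h.deriv_deriv_integral_ge hr s
    nlinarith [norm_nonneg τ]
  · obtain ⟨a, ha, hle⟩ := exists_norm_meanMoment_sub_le hE (measurableSet_Iio (a := s)) (by simp)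
    exact ⟨a, ha, hclose a hle⟩
  · obtain ⟨a, ha, hle⟩ := exists_norm_meanMoment_sub_le hE (measurableSet_Ioi (a := s)) (by simp)
    exact ⟨a, ha, hclose a hle⟩

theorem real_inner_infAction_self (A : Matrix (Fin n) (Fin k) ℤ) (z : CSpace n)
    (ξ : TorusLie k) : inner ℝ z (infAction A z ξ) = 0 := by
  rw [PiLp.inner_apply]
  refine Finset.sum_eq_zero fun j _ => ?_
  simp [infAction, Complex.inner]
  ring

/-- The torus preserves the norm, so `L_z η` is real-orthogonal to `z` and can be added to `∂ₜz` at
no cost. Thus no bound on `η` is needed. -/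
theorem abs_deriv_norm_sq_le (A : Matrix (Fin n) (Fin k) ℤ) {z : ℝ → CSpace n}
    (hz : IsSmoothLoop z) (η : TorusLie k) (t : ℝ) :
    |deriv (fun y => ‖z y‖ ^ 2) t| ≤ ‖z t‖ ^ 2 + ‖deriv z t + infAction A (z t) η‖ ^ 2 := by
  rw [(hz.hasDerivAt t).norm_sq.deriv]
  have e : inner ℝ (z t) (deriv z t) = inner ℝ (z t) (deriv z t + infAction A (z t) η) := by
    rw [inner_add_right, real_inner_infAction_self, add_zero]
  rw [e, abs_mul, abs_two]
  have := abs_real_inner_le_norm (z t) (deriv z t + infAction A (z t) η)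
  nlinarith [sq_nonneg (‖z t‖ - ‖deriv z t + infAction A (z t) η‖)]

/-- Pointwise lower bound for the curvature term in the Laplacian of `‖z‖²`. -/
theorem inner_momentMap_ge {μ m τ : TorusLie k} {r : ℝ} (hr : 0 < r) (hr1 : r ≤ 1) :
    -(‖μ‖ * (‖m‖ + ‖τ‖)) ≤ inner ℝ μ (m - τ + r ^ 2 • (μ - m)) := by
  -- The term quadratic in `μ` has a good sign and is dropped; `r ≤ 1` puts the factor `1 - r²` in
  -- `[0, 1]`, so the bound is linear in `‖μ‖` and uniform in `r`.
  have e : inner ℝ μ (m - τ + r ^ 2 • (μ - m)) =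
      r ^ 2 * ‖μ‖ ^ 2 + (1 - r ^ 2) * inner ℝ μ m - inner ℝ μ τ := by
    rw [inner_add_right, inner_smul_right, ← real_inner_self_eq_norm_sq]
    simp only [inner_sub_right]
    ring
  have h1 := (abs_le.1 (abs_real_inner_le_norm μ m)).1
  have h2 := real_inner_le_norm μ τ
  have h3 : r ^ 2 ≤ 1 := pow_le_one₀ hr.le hr1
  have h4 : 0 ≤ ‖μ‖ * ‖m‖ := by positivity
  rw [e]
  nlinarith [mul_nonneg (sq_nonneg r) (sq_nonneg ‖μ‖), mul_nonneg (sq_nonneg r) h4,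
    mul_le_mul_of_nonneg_left h1 (sub_nonneg.2 h3)]

end MomentFloer

end

/-! ### Choice of the constants and conclusion -/

open MomentFloer in
theorem mainTheorem6 {n k : ℕ} (hkn : k ≤ n) (A : Matrix (Fin n) (Fin k) ℤ) (τ : TorusLie k)
    (hproper : IsProperMap (momentMap A)) (hregular : IsRegularValue (momentMap A) τ) :
    ∃ K : Set (CSpace n), IsCompact K ∧
      ∀ (r : ℝ), 0 < r → r ≤ 1 → ∀ (z : ℝ → ℝ → CSpace n) (η : ℝ → TorusLie k),
        IsFlowLine A τ r z η → energy A τ z η < ⊤ → ∀ s t : ℝ, z s t ∈ K := by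
  obtain ⟨C, hC0, hC⟩ := exists_norm_momentMap_le A
  obtain ⟨c, hc0, hc⟩ := exists_norm_sq_le_norm_momentMap hproper
  obtain ⟨M, hM⟩ : ∃ M, M = c * (‖τ‖ + 1) := ⟨_, rfl⟩
  -- From `Δu ≥ -4‖μ‖(‖m‖ + ‖τ‖)` with `‖μ‖ ≤ C u` and `‖m‖ ≤ C M`.
  obtain ⟨D, hD⟩ : ∃ D, D = 4 * (C * (C * M + ‖τ‖)) := ⟨_, rfl⟩
  have hM0 : 0 ≤ M := by rw [hM]; positivity
  have hD0 : 0 ≤ D := by rw [hD]; positivity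
  obtain ⟨B, hB⟩ : ∃ B, B = 2 * (2 * M + (8 * M * (D + 1) ^ 2 + 1 + ‖τ‖ ^ 2) / 4) := ⟨_, rfl⟩
  refine ⟨Metric.closedBall 0 (B + 1), isCompact_closedBall _ _, fun r hr hr1 z η h hE => ?_⟩
  have hmean : ∀ s, ∫ t in (0 : ℝ)..1, ‖z s t‖ ^ 2 ≤ M := fun s => by
    rw [hM]; exact h.integral_norm_sq_le hr hc0 hc hE s
  have hbound : ∀ s t, ‖z s t‖ ^ 2 ≤ B := by
    rw [hB]
    refine le_of_integral_le (u := fun s t => ‖z s t‖ ^ 2)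
      (D := fun s t => ‖deriv (z s) t + infAction A (z s t) (η s)‖ ^ 2) hD0
      h.contDiff_norm_sq (fun s t => by simp only [h.periodic s t]) (fun s t => sq_nonneg _)
      (fun s => (h.continuous_covariantDeriv s).norm.pow 2) hmean (fun s t => ?_) (fun s => ?_)
      (fun s t => abs_deriv_norm_sq_le A (h.isSmoothLoop s) (η s) t)
    · rw [h.laplacian_norm_sq hr]
      have h1 := inner_momentMap_ge (μ := momentMap A (z s t)) (m := meanMoment A (z s)) (τ := τ)
        hr hr1
      have h2 : ‖meanMoment A (z s)‖ ≤ C * M :=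
        (norm_meanMoment_le hC (h.isSmoothLoop s)).trans (by gcongr; exact hmean s)
      have h3 : ‖momentMap A (z s t)‖ * (‖meanMoment A (z s)‖ + ‖τ‖) ≤
          C * ‖z s t‖ ^ 2 * (C * M + ‖τ‖) := by
        gcongr
        exact hC _
      rw [hD]
      nlinarith [sq_nonneg ‖deriv (z s) t + infAction A (z s t) (η s)‖]
    · refine le_trans ?_ (h.deriv_deriv_integral_ge hr s)
      have h1 := real_inner_le_norm (meanMoment A (z s)) τ
      -- Completing the square: `4(‖m‖² - ‖m‖‖τ‖) ≥ -‖τ‖²`, which is the `L = ‖τ‖²` in `B`.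
      nlinarith [sq_nonneg (2 * ‖meanMoment A (z s)‖ - ‖τ‖)]
  intro s t
  rw [mem_closedBall_zero_iff]
  nlinarith [hbound s t, norm_nonneg (z s t), sq_nonneg (‖z s t‖ - 1)]
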